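/- **Theorem.** Let $N,d\ge 1$ be integers, let $I=[0,1]^N$, and let $H=(H_1,\dots,H_N)\in(0,1)^N$. Let $X_0=\{X_0(t),t\in I\}$ be a real-valued centered Gaussian random field with continuous covariance function $R(s,t)=\mathbb E[X_0(s)X_0(t)]$ satisfying: * (C1) there is a constant $0<c_1<\infty$ such that $\mathbb E\big[(X_0(s)-X_0(t))^2\big]\le c_1\sum_{j=1}^N|s_j-t_j|^{2H_j}$ for all $s,t\in I$; * (C2) there is a constant $c_2>0$ such that $\operatorname{Var}\big(X_0(t)\,\big|\,X_0(s)\big)\ge c_2\sum_{j=1}^N\min\{|s_j-t_j|^{2H_j},|t_j|^{2H_j}\}$ (almost surely) for all $s,t\in I$, where the left-hand side is the conditional variance of $X_0(t)$ given $X_0(s)$. Let $X=\{X(t),t\in I\}$, $X(t)=(X_1(t),\dots,X_d(t))$, be a (jointly measurable) $\mathbb R^d$-valued random field on a probability space $(\Omega,\mathscr F,\mathbb P)$ whose coordinate fields $X_1,\dots,X_d$ are independent copies of $X_0$. For $x\in\mathbb R^d$ and $\varepsilon>0$ put $$L_\varepsilon(x,I,X)=\int_I p_\varepsilon(X(s)-x)\,ds,\qquad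 p_\varepsilon(y)=\frac1{(2\pi\varepsilon)^{d/2}}\exp\Big(-\frac{\|y\|^2}{2\varepsilon}\Big),\quad y\in\mathbb R^d.$$ Then, for every $x\in\mathbb R^d$, $L_\varepsilon(x,I,X)$ converges in $L^2(\Omega,\mathbb P)$ as $\varepsilon\to0^+$ to a limit $L(x,I,X)$ (called the local time of $X$ at level $x$ on $I$) if and only if $\sum_{j=1}^N 1/H_j>d$. -/

import Mathlib

open MeasureTheory ProbabilityTheory Filter
open scoped Topology

noncomputable section

/-- The parameter rectangle `I = [0, 1]^N`. -/
abbrev unitCube (N : ℕ) : Type := Set.Icc (0 : Fin N → ℝ) 1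

/-- Lebesgue measure on `I`. -/
def lebesgueCube (N : ℕ) : Measure (unitCube N) :=
  Measure.comap Subtype.val (volume : Measure (Fin N → ℝ))

/-- `X₀` is a real-valued centered Gaussian random field on `I` with continuous covariance
function `R(s, t) = E[X₀(s) X₀(t)]`. -/
structure IsCenteredGaussianField {N : ℕ} {Ω₀ : Type*} [MeasurableSpace Ω₀]
    (X₀ : unitCube N → Ω₀ → ℝ) (P₀ : Measure Ω₀) : Prop where
  measurable : ∀ t, Measurable (X₀ t)
  gaussian : IsGaussianProcess X₀ P₀
  centered : ∀ t, ∫ ω, X₀ t ω ∂P₀ = 0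
  continuous_cov : Continuous fun p : unitCube N × unitCube N => ∫ ω, X₀ p.1 ω * X₀ p.2 ω ∂P₀

/-- The coordinate fields of the `ℝ^d`-valued random field `X` are independent copies of the
real-valued random field `X₀` (which may live on another probability space). -/
structure CoordsIndepCopies {N d : ℕ} {Ω Ω₀ : Type*} [MeasurableSpace Ω] [MeasurableSpace Ω₀]
    (X : unitCube N → Ω → EuclideanSpace ℝ (Fin d)) (P : Measure Ω)
    (X₀ : unitCube N → Ω₀ → ℝ) (P₀ : Measure Ω₀) : Prop where
  indep : iIndepFun (fun (i : Fin d) (ω : Ω) (t : unitCube N) => X t ω i) P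
  copy : ∀ i : Fin d,
    IdentDistrib (fun (ω : Ω) (t : unitCube N) => X t ω i) (fun (ω : Ω₀) (t : unitCube N) => X₀ t ω)
      P P₀

/-- Condition (C1). -/
def CondC1 {N : ℕ} {Ω₀ : Type*} [MeasurableSpace Ω₀]
    (X₀ : unitCube N → Ω₀ → ℝ) (P₀ : Measure Ω₀) (H : Fin N → ℝ) : Prop :=
  ∃ c₁ : ℝ, 0 < c₁ ∧ ∀ s t : unitCube N,
    ∫ ω, (X₀ s ω - X₀ t ω) ^ 2 ∂P₀ ≤ c₁ * ∑ j, |s.1 j - t.1 j| ^ (2 * H j)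

/-- Condition (C2). The conditional variance of `X₀(t)` given `X₀(s)` is the one with respect to
the σ-algebra generated by `X₀(s)`, and the lower bound holds almost surely. -/
def CondC2 {N : ℕ} {Ω₀ : Type*} [MeasurableSpace Ω₀]
    (X₀ : unitCube N → Ω₀ → ℝ) (P₀ : Measure Ω₀) (H : Fin N → ℝ) : Prop :=
  ∃ c₂ : ℝ, 0 < c₂ ∧ ∀ s t : unitCube N, ∀ᵐ ω ∂P₀,
    c₂ * ∑ j, min (|s.1 j - t.1 j| ^ (2 * H j)) (|t.1 j| ^ (2 * H j)) ≤
      condVar (MeasurableSpace.comap (X₀ s) inferInstance) (X₀ t) P₀ ω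

/-- The heat kernel `p_ε(x) = (2πε)^{-d/2} exp(-‖x‖² / (2ε))` on `ℝ^d`. -/
def heatKernel {d : ℕ} (ε : ℝ) (x : EuclideanSpace ℝ (Fin d)) : ℝ :=
  1 / (2 * Real.pi * ε) ^ ((d : ℝ) / 2) * Real.exp (-(‖x‖ ^ 2 / (2 * ε)))

/-- `L_ε(x, I, X) = ∫_I p_ε(X(s) - x) ds`, a random variable. -/
def approxLocalTime {N d : ℕ} {Ω : Type*} (X : unitCube N → Ω → EuclideanSpace ℝ (Fin d))
    (x : EuclideanSpace ℝ (Fin d)) (ε : ℝ) (ω : Ω) : ℝ :=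
  ∫ s, heatKernel ε (X s ω - x) ∂(lebesgueCube N)

/-- `L` is the local time `L(x, I, X)`: the limit of `L_ε(x, I, X)` in `L²(Ω, P)` as `ε → 0+`. -/
def IsLocalTime {N d : ℕ} {Ω : Type*} [MeasurableSpace Ω]
    (X : unitCube N → Ω → EuclideanSpace ℝ (Fin d)) (P : Measure Ω)
    (x : EuclideanSpace ℝ (Fin d)) (L : Ω → ℝ) : Prop :=
  MemLp L 2 P ∧
    Tendsto (fun ε : ℝ => eLpNorm (fun ω => approxLocalTime X x ε ω - L ω) 2 P) (𝓝[>] 0) (𝓝 0)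

end

noncomputable section

/-! Write `Q = ∑ 1/H_j`. Convergence in `L²` is governed by the mixed moments `E[L_ε L_δ]`. By
Fubini and independence of coordinates these are integrals over pairs `(s, t)` of `heatKernelCorr`,
a product of bivariate Gaussian densities at `(x_i, x_i)` with `ε`, `δ` added to the variances. As
`ε, δ → 0` the singularity is the determinant of the covariance matrix of `(X₀(s), X₀(t))` to the
power `-d/2`.

(C2) bounds this determinant below (`det_lower_bound`): it dominates the variance at `s` times the
bound on the conditional variance. A weighted AM-GM inequality turns these sums into products,
leaving coordinatewise singularities of exponent `d/Q`. If `d < Q` they are integrable, so dominated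
convergence gives a limit of the mixed moments, hence an `L²` limit
(`exists_tendsto_eLpNorm_of_tendsto_integral_mul`).

Conversely, for nearby pairs away from the coordinate hyperplanes, (C1) and (C2) make the
determinant comparable to `ρ = ∑ |t_j - s_j|^{2H_j}`, so the limiting density is at least `κ
ρ^(-d/2)` (`exists_heatKernelCorr_ge`). If `Q ≤ d` this has infinite integral, by anisotropic
scaling (`lintegral_anisoGauge_eq_top`), while Fatou and `L²` convergence would make it finite. -/

/-! ### Gaussian integrals and Fourier representation -/

/-- The one-dimensional heat kernel. -/
def heatKernelReal (ε y : ℝ) : ℝ := (√(2 * Real.pi * ε))⁻¹ * Real.exp (-(y ^ 2 / (2 * ε)))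

lemma ofReal_sqrt_eq_cpow {r : ℝ} (hr : 0 ≤ r) : ((√r : ℝ) : ℂ) = (r : ℂ) ^ (1 / 2 : ℂ) := by
  rw [Real.sqrt_eq_rpow, Complex.ofReal_cpow hr]; norm_num

/-- Fourier inversion: expectations of heat kernels become integrals of characteristic functions.
The `+ 0` matches the shape of `integral_cexp_quadratic`. -/
lemma heatKernelReal_eq_integral {ε : ℝ} (hε : 0 < ε) (y : ℝ) :
    (heatKernelReal ε y : ℂ) = (2 * Real.pi : ℂ)⁻¹ *
      ∫ ξ : ℝ, Complex.exp (-(ε / 2 : ℝ) * ξ ^ 2 + Complex.I * y * ξ + 0) := by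
  have hp := Real.pi_pos
  rw [integral_cexp_quadratic (by simpa using hε)]
  have h1 : (Real.pi / -(-(ε / 2 : ℝ)) : ℂ) = ((2 * Real.pi / ε : ℝ) : ℂ) := by
    have : (ε : ℂ) ≠ 0 := by exact_mod_cast hε.ne'
    push_cast; field_simp
  rw [h1, ← ofReal_sqrt_eq_cpow (by positivity)]
  have h2 : (0 - (Complex.I * y) ^ 2 / (4 * -(ε / 2 : ℝ)) : ℂ) = ((-(y ^ 2 / (2 * ε)) : ℝ) : ℂ) := by
    have : (ε : ℂ) ≠ 0 := by exact_mod_cast hε.ne'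
    rw [mul_pow, Complex.I_sq]
    push_cast; field_simp; ring
  rw [h2, ← Complex.ofReal_exp, heatKernelReal]
  have h3 : (√(2 * Real.pi * ε))⁻¹ = (2 * Real.pi)⁻¹ * √(2 * Real.pi / ε) := by
    rw [Real.sqrt_div (by positivity), Real.sqrt_mul (by positivity)]
    have := Real.sqrt_pos.2 hε
    have h4 := Real.sqrt_pos.2 (show 0 < 2 * Real.pi by positivity)
    field_simp
    rw [Real.sq_sqrt (by positivity)]
  rw [h3]; push_cast; ring

/-- The density at `(x, x)` of the centered Gaussian law on `ℝ²` with covariance matrix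
`[[A, b], [b, C]]`. -/
def gaussianDensityDiag (A b C x : ℝ) : ℝ :=
  (2 * Real.pi * √(A * C - b ^ 2))⁻¹ *
    Real.exp (-(x ^ 2 * (A + C - 2 * b) / (2 * (A * C - b ^ 2))))

/-- Integrating out `η` leaves a Gaussian in `ξ` whose quadratic coefficient is half the Schur
complement `(A * C - b ^ 2) / C`. -/
lemma integral_integral_cexp_quadratic {A b C : ℝ} (hC : 0 < C) (hD : 0 < A * C - b ^ 2) (x : ℝ) :
    ∫ ξ : ℝ, ∫ η : ℝ, Complex.exp (-(C / 2 : ℝ) * η ^ 2 + (-b * ξ - Complex.I * x) * η +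
        (-(A / 2 : ℝ) * ξ ^ 2 - Complex.I * x * ξ)) =
      (2 * Real.pi : ℂ) ^ 2 * gaussianDensityDiag A b C x := by
  have hp := Real.pi_pos
  have hC' : (C : ℂ) ≠ 0 := by exact_mod_cast hC.ne'
  have hD' : (A * C - b ^ 2 : ℂ) ≠ 0 := by exact_mod_cast hD.ne'
  have key : ∀ ξ : ℝ, ∫ η : ℝ, Complex.exp (-(C / 2 : ℝ) * η ^ 2 + (-b * ξ - Complex.I * x) * η +
        (-(A / 2 : ℝ) * ξ ^ 2 - Complex.I * x * ξ)) = (√(2 * Real.pi / C) : ℝ) *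
        Complex.exp (-((A * C - b ^ 2) / (2 * C) : ℝ) * ξ ^ 2 +
          Complex.I * (x * (b / C - 1)) * ξ + ((-(x ^ 2 / (2 * C)) : ℝ) : ℂ)) := by
    intro ξ
    rw [integral_cexp_quadratic (by simpa using hC), ofReal_sqrt_eq_cpow (by positivity)]
    congr 2
    · push_cast; field_simp
    · push_cast; field_simp
      ring_nf
      rw [Complex.I_sq]; ring
  simp_rw [key]
  rw [integral_const_mul, integral_cexp_quadratic (by
    rw [← Complex.ofReal_neg, Complex.ofReal_re]; exact neg_neg_of_pos (by positivity))]
  have h1 : (Real.pi / -(-((A * C - b ^ 2) / (2 * C) : ℝ)) : ℂ) =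
      ((2 * Real.pi * C / (A * C - b ^ 2) : ℝ) : ℂ) := by
    push_cast; field_simp
  rw [h1, ← ofReal_sqrt_eq_cpow (by positivity)]
  have h2 : (((-(x ^ 2 / (2 * C)) : ℝ) : ℂ) - (Complex.I * (x * (b / C - 1))) ^ 2 /
      (4 * -((A * C - b ^ 2) / (2 * C) : ℝ)) : ℂ) =
      ((-(x ^ 2 * (A + C - 2 * b) / (2 * (A * C - b ^ 2))) : ℝ) : ℂ) := by
    rw [mul_pow, Complex.I_sq]
    push_cast
    -- Eliminating `A` in favour of the determinant `D` makes every denominator a monomial in `C`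
    -- and `D`.
    obtain ⟨D, hDA⟩ : ∃ D : ℂ, (A * C - b ^ 2 : ℂ) = D := ⟨_, rfl⟩
    have hA : (A : ℂ) = (D + b ^ 2) / C := by rw [← hDA]; field_simp; ring
    rw [hDA] at hD' ⊢
    rw [hA]; field_simp; ring
  rw [h2, ← Complex.ofReal_exp, ← mul_assoc, ← Complex.ofReal_mul]
  have h3 : √(2 * Real.pi / C) * √(2 * Real.pi * C / (A * C - b ^ 2)) =
      (2 * Real.pi) ^ 2 * (2 * Real.pi * √(A * C - b ^ 2))⁻¹ := by
    rw [← Real.sqrt_mul (by positivity),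
      show 2 * Real.pi / C * (2 * Real.pi * C / (A * C - b ^ 2)) =
        (2 * Real.pi) ^ 2 / (A * C - b ^ 2) by field_simp,
      Real.sqrt_div (by positivity), Real.sqrt_sq (by positivity)]
    have := Real.sqrt_pos.2 hD
    field_simp
  rw [h3, gaussianDensityDiag]; push_cast; ring

/-- Justifies Fubini: the terms in `U`, `V` are pure phases, so the modulus is a fixed Gaussian in
the frequencies. -/
lemma integrable_cexp_prod {ε δ : ℝ} (hε : 0 < ε) (hδ : 0 < δ) {Ω : Type*} [MeasurableSpace Ω]
    (P : Measure Ω) [IsProbabilityMeasure P] {U V : Ω → ℝ} (hU : Measurable U)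
    (hV : Measurable V) :
    Integrable (fun p : Ω × (ℝ × ℝ) =>
      Complex.exp (-(ε / 2 : ℝ) * p.2.1 ^ 2 + Complex.I * U p.1 * p.2.1 + 0) *
      Complex.exp (-(δ / 2 : ℝ) * p.2.2 ^ 2 + Complex.I * V p.1 * p.2.2 + 0))
      (P.prod (volume.prod volume)) := by
  have h0 : Integrable (fun p : ℝ × ℝ => Real.exp (-(ε / 2) * p.1 ^ 2) *
      Real.exp (-(δ / 2) * p.2 ^ 2)) (volume.prod volume) :=
    (integrable_exp_neg_mul_sq (half_pos hε)).mul_prod (integrable_exp_neg_mul_sq (half_pos hδ))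
  refine (h0.comp_snd P).mono' ?_ (ae_of_all _ fun p => ?_)
  · exact Measurable.aestronglyMeasurable (by fun_prop)
  · rw [norm_mul, Complex.norm_exp, Complex.norm_exp]
    apply le_of_eq
    congr 2 <;> simp [← Complex.ofReal_pow]

/-- If `(U, V)` is a centered Gaussian vector, then `E[p_ε(U - x) p_δ(V - x)]` is a value of the
density of `(U + √ε Z, V + √δ Z')`. -/
lemma integral_heatKernelReal_mul {Ω : Type*} [MeasurableSpace Ω] (P : Measure Ω)
    [IsProbabilityMeasure P] {U V : Ω → ℝ} (hU : Measurable U) (hV : Measurable V) {a b c : ℝ}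
    (hchar : ∀ ξ η : ℝ, ∫ ω, Complex.exp (Complex.I * (ξ * U ω + η * V ω)) ∂P =
      Complex.exp (-(a * ξ ^ 2 + 2 * b * ξ * η + c * η ^ 2) / 2))
    {ε δ : ℝ} (hε : 0 < ε) (hδ : 0 < δ) (hC : 0 < c + δ) (hD : 0 < (a + ε) * (c + δ) - b ^ 2)
    (x : ℝ) :
    ∫ ω, heatKernelReal ε (U ω - x) * heatKernelReal δ (V ω - x) ∂P =
      gaussianDensityDiag (a + ε) b (c + δ) x := by
  have hp : (Real.pi : ℂ) ≠ 0 := by exact_mod_cast Real.pi_ne_zero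
  have hint := integrable_cexp_prod hε hδ P (hU.sub_const x) (hV.sub_const x)
  have e1 : ∀ ω, ((heatKernelReal ε (U ω - x) * heatKernelReal δ (V ω - x) : ℝ) : ℂ) =
      ((2 * Real.pi : ℂ) ^ 2)⁻¹ * ∫ p : ℝ × ℝ,
      Complex.exp (-(ε / 2 : ℝ) * p.1 ^ 2 + Complex.I * (U ω - x : ℝ) * p.1 + 0) *
      Complex.exp (-(δ / 2 : ℝ) * p.2 ^ 2 + Complex.I * (V ω - x : ℝ) * p.2 + 0)
        ∂(volume.prod volume) := by
    intro ω
    rw [integral_prod_mul (fun ξ : ℝ => Complex.exp (-(ε / 2 : ℝ) * ξ ^ 2 +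
      Complex.I * (U ω - x : ℝ) * ξ + 0)) (fun ξ : ℝ => Complex.exp (-(δ / 2 : ℝ) * ξ ^ 2 +
      Complex.I * (V ω - x : ℝ) * ξ + 0)),
      Complex.ofReal_mul, heatKernelReal_eq_integral hε, heatKernelReal_eq_integral hδ]
    ring
  have e2 : ∀ p : ℝ × ℝ, ∫ ω,
      Complex.exp (-(ε / 2 : ℝ) * p.1 ^ 2 + Complex.I * (U ω - x : ℝ) * p.1 + 0) *
      Complex.exp (-(δ / 2 : ℝ) * p.2 ^ 2 + Complex.I * (V ω - x : ℝ) * p.2 + 0) ∂P =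
      Complex.exp (-((c + δ) / 2 : ℝ) * p.2 ^ 2 + (-b * p.1 - Complex.I * x) * p.2 +
        (-((a + ε) / 2 : ℝ) * p.1 ^ 2 - Complex.I * x * p.1)) := by
    intro p
    have : ∀ ω, Complex.exp (-(ε / 2 : ℝ) * p.1 ^ 2 + Complex.I * (U ω - x : ℝ) * p.1 + 0) *
      Complex.exp (-(δ / 2 : ℝ) * p.2 ^ 2 + Complex.I * (V ω - x : ℝ) * p.2 + 0) =
      Complex.exp (-(ε / 2 : ℝ) * p.1 ^ 2 - (δ / 2 : ℝ) * p.2 ^ 2 - Complex.I * x * (p.1 + p.2)) *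
      Complex.exp (Complex.I * (p.1 * U ω + p.2 * V ω)) := by
      intro ω
      rw [← Complex.exp_add, ← Complex.exp_add]
      congr 1; push_cast; ring
    simp_rw [this]
    rw [integral_const_mul, hchar, ← Complex.exp_add]
    congr 1; push_cast; ring
  apply Complex.ofReal_injective
  rw [← integral_complex_ofReal]
  simp_rw [e1]
  rw [integral_const_mul, integral_integral_swap hint]
  have hint2 := hint.integral_prod_right
  dsimp only at hint2
  simp_rw [e2] at hint2 ⊢
  rw [integral_prod _ hint2, integral_integral_cexp_quadratic hC hD x]
  field_simp

/-! ### Conditional variance, covariances and characteristic functions -/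

/-- Subtracting the `U`-measurable `β * U` does not change the conditional variance; then the law of
total variance applies to the residual. This extracts covariance bounds from (C2) without the
Gaussian conditioning formula. -/
lemma integral_condVar_le_integral_sub_sq {Ω : Type*} [MeasurableSpace Ω] {P : Measure Ω}
    [IsProbabilityMeasure P] {U Y : Ω → ℝ} (hUm : Measurable U) (hU : MemLp U 2 P)
    (hY : MemLp Y 2 P) (β : ℝ) :
    ∫ ω, condVar (MeasurableSpace.comap U inferInstance) Y P ω ∂P ≤
      ∫ ω, (Y ω - β * U ω) ^ 2 ∂P := by
  set m := MeasurableSpace.comap U inferInstance with hm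
  have hle : m ≤ _ := hUm.comap_le
  have hβ : MemLp (fun ω => β * U ω) 2 P := hU.const_mul β
  have hsm : StronglyMeasurable[m] (fun ω => β * U ω) :=
    ((comap_measurable U).const_mul β).stronglyMeasurable
  have hcv : condVar m Y P =ᵐ[P] condVar m (Y - fun ω => β * U ω) P := by
    refine condExp_congr_ae ?_
    filter_upwards [condExp_sub (m := m) (hY.integrable one_le_two) (hβ.integrable one_le_two)]
      with ω hω
    simp only [Pi.pow_apply, Pi.sub_apply] at hω ⊢
    rw [hω, condExp_of_stronglyMeasurable hle hsm (hβ.integrable one_le_two)]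
    ring
  rw [integral_congr_ae hcv]
  have h1 := integral_condVar_add_variance_condExp hle (hY.sub hβ)
  have h2 := variance_nonneg (P[Y - fun ω => β * U ω | m]) P
  have h3 := variance_le_expectation_sq (μ := P) (X := Y - fun ω => β * U ω)
    (hY.sub hβ).aestronglyMeasurable
  simp only [Pi.pow_apply, Pi.sub_apply] at h3
  linarith

/-- The covariance function of a centered random field. -/
def covFun {T Ω₀ : Type*} [MeasurableSpace Ω₀] (X₀ : T → Ω₀ → ℝ) (P₀ : Measure Ω₀) (s t : T) : ℝ :=
  ∫ ω, X₀ s ω * X₀ t ω ∂P₀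

lemma integral_linear_comb_sq {T Ω₀ : Type*} [MeasurableSpace Ω₀] {X₀ : T → Ω₀ → ℝ}
    {P₀ : Measure Ω₀} (h : ∀ t, MemLp (X₀ t) 2 P₀) (s t : T) (ξ η : ℝ) :
    ∫ ω, (ξ * X₀ s ω + η * X₀ t ω) ^ 2 ∂P₀ =
      covFun X₀ P₀ s s * ξ ^ 2 + 2 * covFun X₀ P₀ s t * ξ * η + covFun X₀ P₀ t t * η ^ 2 := by
  have hi : ∀ s t, Integrable (fun ω => X₀ s ω * X₀ t ω) P₀ := fun s t =>
    (h s).integrable_mul (h t)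
  have e : ∀ ω, (ξ * X₀ s ω + η * X₀ t ω) ^ 2 = ξ ^ 2 * (X₀ s ω * X₀ s ω) +
      (2 * ξ * η) * (X₀ s ω * X₀ t ω) + η ^ 2 * (X₀ t ω * X₀ t ω) := fun ω => by ring
  simp_rw [e]
  have hi2 : Integrable (fun ω => ξ ^ 2 * (X₀ s ω * X₀ s ω) + (2 * ξ * η) * (X₀ s ω * X₀ t ω)) P₀ :=
    ((hi s s).const_mul _).add ((hi s t).const_mul _)
  rw [integral_add hi2 ((hi t t).const_mul _),
    integral_add ((hi s s).const_mul _) ((hi s t).const_mul _)]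
  simp only [integral_const_mul, covFun]
  ring

lemma covFun_self_nonneg {T Ω₀ : Type*} [MeasurableSpace Ω₀] (X₀ : T → Ω₀ → ℝ)
    (P₀ : Measure Ω₀) (s : T) : 0 ≤ covFun X₀ P₀ s s :=
  integral_nonneg fun _ => mul_self_nonneg _

lemma covFun_sq_le {T Ω₀ : Type*} [MeasurableSpace Ω₀] {X₀ : T → Ω₀ → ℝ}
    {P₀ : Measure Ω₀} (h : ∀ t, MemLp (X₀ t) 2 P₀) (s t : T) :
    0 ≤ covFun X₀ P₀ s s * covFun X₀ P₀ t t - covFun X₀ P₀ s t ^ 2 := by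
  have key : ∀ ξ : ℝ, 0 ≤ covFun X₀ P₀ s s * (ξ * ξ) + (2 * covFun X₀ P₀ s t) * ξ +
      covFun X₀ P₀ t t := fun ξ => by
    have h1 := integral_linear_comb_sq h s t ξ 1
    have h2 : 0 ≤ ∫ ω, (ξ * X₀ s ω + 1 * X₀ t ω) ^ 2 ∂P₀ := integral_nonneg fun ω => sq_nonneg _
    nlinarith
  have := discrim_le_zero key
  unfold discrim at this
  nlinarith

namespace IsCenteredGaussianField

variable {N : ℕ} {Ω₀ : Type*} [MeasurableSpace Ω₀] {P₀ : Measure Ω₀} {X₀ : unitCube N → Ω₀ → ℝ}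

lemma memLp_two (hX₀ : IsCenteredGaussianField X₀ P₀) (t : unitCube N) : MemLp (X₀ t) 2 P₀ :=
  (hX₀.gaussian.hasGaussianLaw_eval t).memLp_two

lemma integral_cexp (hX₀ : IsCenteredGaussianField X₀ P₀) [IsProbabilityMeasure P₀]
    (s t : unitCube N) (ξ η : ℝ) :
    ∫ ω, Complex.exp (Complex.I * (ξ * X₀ s ω + η * X₀ t ω)) ∂P₀ =
      Complex.exp (-(covFun X₀ P₀ s s * ξ ^ 2 + 2 * covFun X₀ P₀ s t * ξ * η +
        covFun X₀ P₀ t t * η ^ 2) / 2) := by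
  have hm : Measurable (fun ω => ξ * X₀ s ω + η * X₀ t ω) :=
    ((hX₀.measurable s).const_mul ξ).add ((hX₀.measurable t).const_mul η)
  have hg : HasGaussianLaw (fun ω => ξ * X₀ s ω + η * X₀ t ω) P₀ :=
    (hX₀.gaussian.hasGaussianLaw_prodMk (s := s) (t := t)).map_fun
      (ξ • ContinuousLinearMap.fst ℝ ℝ ℝ + η • ContinuousLinearMap.snd ℝ ℝ ℝ)
  have h0 : ∫ ω, (ξ * X₀ s ω + η * X₀ t ω) ∂P₀ = 0 := by
    rw [integral_add (((hX₀.memLp_two s).integrable one_le_two).const_mul ξ)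
      (((hX₀.memLp_two t).integrable one_le_two).const_mul η)]
    simp [integral_const_mul, hX₀.centered]
  have hv := variance_of_integral_eq_zero hm.aemeasurable h0
  rw [integral_linear_comb_sq hX₀.memLp_two] at hv
  have hv0 := variance_nonneg (fun ω => ξ * X₀ s ω + η * X₀ t ω) P₀
  -- The joint characteristic function is that of the scalar Gaussian `ξ X₀(s) + η X₀(t)` at
  -- frequency `1`.
  have h1 := charFun_gaussianReal (μ := ∫ ω, (ξ * X₀ s ω + η * X₀ t ω) ∂P₀)
    (v := (variance (fun ω => ξ * X₀ s ω + η * X₀ t ω) P₀).toNNReal) 1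
  rw [← hg.map_eq_gaussianReal, charFun_apply_real, integral_map hm.aemeasurable
    (by fun_prop), h0] at h1
  have h2 : ((variance (fun ω => ξ * X₀ s ω + η * X₀ t ω) P₀).toNNReal : ℂ) =
    ((variance (fun ω => ξ * X₀ s ω + η * X₀ t ω) P₀ : ℝ) : ℂ) := by
    exact congrArg Complex.ofReal (Real.coe_toNNReal _ hv0)
  rw [h2, hv] at h1
  convert h1 using 3
  · push_cast; ring_nf
  · push_cast; ring

lemma covFun_continuous (hX₀ : IsCenteredGaussianField X₀ P₀) :
    Continuous fun p : unitCube N × unitCube N => covFun X₀ P₀ p.1 p.2 :=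
  hX₀.continuous_cov

end IsCenteredGaussianField

/-! ### Two-point correlations of the heat kernels -/

lemma heatKernel_eq_prod {d : ℕ} {ε : ℝ} (hε : 0 < ε) (y : EuclideanSpace ℝ (Fin d)) :
    heatKernel ε y = ∏ i, heatKernelReal ε (y i) := by
  have h0 : (0 : ℝ) < 2 * Real.pi * ε := by positivity
  simp only [heatKernel, heatKernelReal]
  rw [Finset.prod_mul_distrib, ← Real.exp_sum, EuclideanSpace.norm_sq_eq, Finset.prod_const,
    Finset.card_univ, Fintype.card_fin, Finset.sum_neg_distrib, Finset.sum_div]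
  simp only [Real.norm_eq_abs, sq_abs]
  congr 1
  rw [one_div, inv_pow, Real.sqrt_eq_rpow, ← Real.rpow_natCast, ← Real.rpow_mul h0.le]
  congr 2; ring

lemma measurable_heatKernelReal (ε : ℝ) : Measurable (heatKernelReal ε) := by
  unfold heatKernelReal; fun_prop

/-- `E[p_ε(X(s) - x) p_δ(X(t) - x)]` as an explicit function of the covariances. -/
def heatKernelCorr {N d : ℕ} {Ω₀ : Type*} [MeasurableSpace Ω₀] (X₀ : unitCube N → Ω₀ → ℝ)
    (P₀ : Measure Ω₀) (x : EuclideanSpace ℝ (Fin d)) (ε δ : ℝ) (p : unitCube N × unitCube N) : ℝ :=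
  ∏ i, gaussianDensityDiag (covFun X₀ P₀ p.1 p.1 + ε) (covFun X₀ P₀ p.1 p.2)
    (covFun X₀ P₀ p.2 p.2 + δ) (x i)

lemma integral_heatKernel_mul {N d : ℕ} {Ω Ω₀ : Type*} [MeasurableSpace Ω] [MeasurableSpace Ω₀]
    {P : Measure Ω} {P₀ : Measure Ω₀} [IsProbabilityMeasure P₀]
    {X₀ : unitCube N → Ω₀ → ℝ} (hX₀ : IsCenteredGaussianField X₀ P₀)
    {X : unitCube N → Ω → EuclideanSpace ℝ (Fin d)}
    (hXmeas : Measurable (Function.uncurry X)) (hX : CoordsIndepCopies X P X₀ P₀)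
    (x : EuclideanSpace ℝ (Fin d)) {ε δ : ℝ} (hε : 0 < ε) (hδ : 0 < δ) (s t : unitCube N) :
    ∫ ω, heatKernel ε (X s ω - x) * heatKernel δ (X t ω - x) ∂P =
      heatKernelCorr X₀ P₀ x ε δ (s, t) := by
  have hXs : ∀ s, Measurable (X s) := fun s => hXmeas.comp measurable_prodMk_left
  have hXsi : ∀ s i, Measurable fun ω => X s ω i := fun s i =>
    (EuclideanSpace.proj (𝕜 := ℝ) i).continuous.measurable.comp (hXs s)
  have hg : ∀ i, Measurable fun f : unitCube N → ℝ =>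
      heatKernelReal ε (f s - x i) * heatKernelReal δ (f t - x i) := fun i =>
    ((measurable_heatKernelReal ε).comp ((measurable_pi_apply s).sub_const _)).mul
      ((measurable_heatKernelReal δ).comp ((measurable_pi_apply t).sub_const _))
  have hprod : ∀ ω, heatKernel ε (X s ω - x) * heatKernel δ (X t ω - x) =
      ∏ i, heatKernelReal ε (X s ω i - x i) * heatKernelReal δ (X t ω i - x i) := fun ω => by
    rw [heatKernel_eq_prod hε, heatKernel_eq_prod hδ, ← Finset.prod_mul_distrib]
    rfl
  simp_rw [hprod]
  have hind := hX.indep.comp _ hg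
  have hi := hind.integral_fun_prod_eq_prod_integral (fun i => Measurable.aestronglyMeasurable
    ((hg i).comp (measurable_pi_lambda _ fun s => hXsi s i)))
  simp only [Function.comp_apply] at hi
  rw [hi, heatKernelCorr]
  refine Finset.prod_congr rfl fun i _ => ?_
  have := ((hX.copy i).comp (hg i)).integral_eq
  simp only [Function.comp_def] at this ⊢
  rw [this]
  have h1 := covFun_self_nonneg X₀ P₀ s
  have h2 := covFun_self_nonneg X₀ P₀ t
  have h3 := covFun_sq_le hX₀.memLp_two s t
  refine integral_heatKernelReal_mul P₀ (hX₀.measurable s) (hX₀.measurable t)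
    (hX₀.integral_cexp s t) hε hδ (by positivity) ?_ (x i)
  have := mul_nonneg h1 hδ.le
  have := mul_nonneg h2 hε.le
  have := mul_pos hε hδ
  nlinarith

/-! ### Covariance inequalities from (C2) -/

/-- The slope `β` stays free: the regression slope will give the determinant, and `β = 0` the
variance. -/
lemma condC2_le_integral_sub_sq {N : ℕ} {Ω₀ : Type*} [MeasurableSpace Ω₀] {P₀ : Measure Ω₀}
    [IsProbabilityMeasure P₀] {X₀ : unitCube N → Ω₀ → ℝ} (hX₀ : IsCenteredGaussianField X₀ P₀)
    {s t : unitCube N} {v : ℝ}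
    (h : ∀ᵐ ω ∂P₀, v ≤ condVar (MeasurableSpace.comap (X₀ s) inferInstance) (X₀ t) P₀ ω) (β : ℝ) :
    v ≤ covFun X₀ P₀ t t - 2 * β * covFun X₀ P₀ s t + β ^ 2 * covFun X₀ P₀ s s := by
  have h1 := integral_condVar_le_integral_sub_sq (hX₀.measurable s) (hX₀.memLp_two s)
    (hX₀.memLp_two t) β
  have h2 : v ≤ ∫ ω, condVar (MeasurableSpace.comap (X₀ s) inferInstance) (X₀ t) P₀ ω ∂P₀ := by
    have := integral_mono_ae (integrable_const v) (integrable_condVar) h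
    simpa using this
  have h3 := integral_linear_comb_sq hX₀.memLp_two s t (-β) 1
  have h4 : ∀ ω, (X₀ t ω - β * X₀ s ω) ^ 2 = (-β * X₀ s ω + 1 * X₀ t ω) ^ 2 := fun ω => by ring
  simp_rw [h4] at h1
  linarith

/-- Two-point nondegeneracy extracted from (C2). -/
lemma condC2_mul_le_det {N : ℕ} {Ω₀ : Type*} [MeasurableSpace Ω₀] {P₀ : Measure Ω₀}
    [IsProbabilityMeasure P₀] {X₀ : unitCube N → Ω₀ → ℝ} (hX₀ : IsCenteredGaussianField X₀ P₀)
    {s t : unitCube N} {v : ℝ}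
    (h : ∀ᵐ ω ∂P₀, v ≤ condVar (MeasurableSpace.comap (X₀ s) inferInstance) (X₀ t) P₀ ω) :
    covFun X₀ P₀ s s * v ≤ covFun X₀ P₀ s s * covFun X₀ P₀ t t - covFun X₀ P₀ s t ^ 2 := by
  rcases (covFun_self_nonneg X₀ P₀ s).eq_or_lt with h0 | h0
  · have := covFun_sq_le hX₀.memLp_two s t
    rw [← h0] at this ⊢
    simpa using this
  -- With the least-squares slope the residual variance is the determinant divided by the variance
  -- at `s`.
  · have := condC2_le_integral_sub_sq hX₀ h (covFun X₀ P₀ s t / covFun X₀ P₀ s s)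
    have := mul_le_mul_of_nonneg_left this h0.le
    refine this.trans (le_of_eq ?_)
    field_simp
    ring

lemma condC2_le_variance {N : ℕ} {Ω₀ : Type*} [MeasurableSpace Ω₀] {P₀ : Measure Ω₀}
    [IsProbabilityMeasure P₀] {X₀ : unitCube N → Ω₀ → ℝ} (hX₀ : IsCenteredGaussianField X₀ P₀)
    {H : Fin N → ℝ} {c₂ : ℝ}
    (h : ∀ s t : unitCube N, ∀ᵐ ω ∂P₀,
      c₂ * ∑ j, min (|s.1 j - t.1 j| ^ (2 * H j)) (|t.1 j| ^ (2 * H j)) ≤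
        condVar (MeasurableSpace.comap (X₀ s) inferInstance) (X₀ t) P₀ ω) (s : unitCube N) :
    c₂ * ∑ j, |s.1 j| ^ (2 * H j) ≤ covFun X₀ P₀ s s := by
  -- Conditioning at the origin makes the two arguments of each minimum equal.
  have := condC2_le_integral_sub_sq hX₀ (h ⟨0, by simp⟩ s) 0
  simpa using this

/-- With `a`, `c` the variances and `b` the covariance, `ac - b² = a(a + c - 2b) - (a - b)²`; the
factor `a + c - 2b` is the increment variance controlled by (C1). -/
lemma det_le_covFun_mul {T Ω₀ : Type*} [MeasurableSpace Ω₀] {X₀ : T → Ω₀ → ℝ}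
    {P₀ : Measure Ω₀} (s t : T) :
    covFun X₀ P₀ s s * covFun X₀ P₀ t t - covFun X₀ P₀ s t ^ 2 ≤ covFun X₀ P₀ s s *
      (covFun X₀ P₀ s s + covFun X₀ P₀ t t - 2 * covFun X₀ P₀ s t) := by
  nlinarith [sq_nonneg (covFun X₀ P₀ s s - covFun X₀ P₀ s t)]

lemma integral_sub_sq_eq_covFun {T Ω₀ : Type*} [MeasurableSpace Ω₀] {X₀ : T → Ω₀ → ℝ}
    {P₀ : Measure Ω₀} (h : ∀ t, MemLp (X₀ t) 2 P₀) (s t : T) :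
    ∫ ω, (X₀ s ω - X₀ t ω) ^ 2 ∂P₀ =
      covFun X₀ P₀ s s + covFun X₀ P₀ t t - 2 * covFun X₀ P₀ s t := by
  have h3 := integral_linear_comb_sq h s t 1 (-1)
  have h4 : ∀ ω, (X₀ s ω - X₀ t ω) ^ 2 = (1 * X₀ s ω + -1 * X₀ t ω) ^ 2 := fun ω => by ring
  simp_rw [h4]
  rw [h3]; ring

/-! ### Lebesgue measure on the cube and second moments of the approximations -/

lemma measurePreserving_val_lebesgueCube (N : ℕ) :
    MeasurePreserving Subtype.val (lebesgueCube N)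
      (Measure.pi fun _ : Fin N => (volume : Measure ℝ).restrict (Set.Icc 0 1)) := by
  refine ⟨measurable_subtype_coe, ?_⟩
  rw [lebesgueCube, map_comap_subtype_coe measurableSet_Icc, ← Measure.restrict_pi_pi,
    volume_pi]
  congr 1
  exact (Set.pi_univ_Icc _ _).symm

instance (N : ℕ) : IsFiniteMeasure (lebesgueCube N) := by
  refine ⟨?_⟩
  have h := (measurePreserving_val_lebesgueCube N).measure_preimage
    (s := Set.univ) MeasurableSet.univ.nullMeasurableSet
  rw [Set.preimage_univ] at h
  rw [h]
  exact measure_lt_top _ _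

/-- Reading a pair of points of the cube coordinatewise preserves the measure. -/
lemma measurePreserving_coords_lebesgueCube (N : ℕ) :
    MeasurePreserving
      (fun (p : unitCube N × unitCube N) (j : Fin N) => (p.1.1 j, p.2.1 j))
      ((lebesgueCube N).prod (lebesgueCube N))
      (Measure.pi fun _ : Fin N => ((volume : Measure ℝ).restrict (Set.Icc 0 1)).prod
        ((volume : Measure ℝ).restrict (Set.Icc 0 1))) :=
  (measurePreserving_arrowProdEquivProdArrow ℝ ℝ (Fin N) _ _).symm.comp
    ((measurePreserving_val_lebesgueCube N).prod (measurePreserving_val_lebesgueCube N))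

lemma heatKernel_nonneg {d : ℕ} {ε : ℝ} (hε : 0 < ε) (y : EuclideanSpace ℝ (Fin d)) :
    0 ≤ heatKernel ε y := by
  unfold heatKernel; positivity

lemma norm_heatKernel_le {d : ℕ} {ε : ℝ} (hε : 0 < ε) (y : EuclideanSpace ℝ (Fin d)) :
    ‖heatKernel ε y‖ ≤ 1 / (2 * Real.pi * ε) ^ ((d : ℝ) / 2) := by
  rw [Real.norm_of_nonneg (heatKernel_nonneg hε y), heatKernel]
  refine mul_le_of_le_one_right (by positivity) (Real.exp_le_one_iff.2 ?_)
  exact neg_nonpos.2 (by positivity)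

lemma measurable_heatKernel {d : ℕ} (ε : ℝ) :
    Measurable (heatKernel ε : EuclideanSpace ℝ (Fin d) → ℝ) := by
  unfold heatKernel; fun_prop

section SecondMoment

variable {N d : ℕ} {Ω Ω₀ : Type*} [MeasurableSpace Ω] [MeasurableSpace Ω₀]
    {P : Measure Ω} [IsProbabilityMeasure P] {P₀ : Measure Ω₀} [IsProbabilityMeasure P₀]
    {X₀ : unitCube N → Ω₀ → ℝ} {X : unitCube N → Ω → EuclideanSpace ℝ (Fin d)}

lemma memLp_approxLocalTime (hXmeas : Measurable (Function.uncurry X))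
    (x : EuclideanSpace ℝ (Fin d)) {ε : ℝ} (hε : 0 < ε) :
    MemLp (approxLocalTime X x ε) 2 P := by
  have hm : StronglyMeasurable (fun q : Ω × unitCube N => heatKernel ε (X q.2 q.1 - x)) :=
    ((measurable_heatKernel ε).comp ((hXmeas.comp measurable_swap).sub_const x)).stronglyMeasurable
  refine MemLp.of_bound (C := 1 / (2 * Real.pi * ε) ^ ((d : ℝ) / 2) *
    (lebesgueCube N).real Set.univ) (hm.integral_prod_right').aestronglyMeasurable
    (ae_of_all _ fun ω => ?_)
  exact norm_integral_le_of_norm_le_const (ae_of_all _ fun s => norm_heatKernel_le hε _)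

/-- The mixed second moments of the approximations. -/
lemma integral_approxLocalTime_mul (hX₀ : IsCenteredGaussianField X₀ P₀)
    (hXmeas : Measurable (Function.uncurry X)) (hX : CoordsIndepCopies X P X₀ P₀)
    (x : EuclideanSpace ℝ (Fin d)) {ε δ : ℝ} (hε : 0 < ε) (hδ : 0 < δ) :
    ∫ ω, approxLocalTime X x ε ω * approxLocalTime X x δ ω ∂P =
      ∫ p, heatKernelCorr X₀ P₀ x ε δ p ∂((lebesgueCube N).prod (lebesgueCube N)) := by
  have hm : ∀ ε, Measurable (fun q : Ω × unitCube N => heatKernel ε (X q.2 q.1 - x)) := fun ε =>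
    (measurable_heatKernel ε).comp ((hXmeas.comp measurable_swap).sub_const x)
  have hint : Integrable (fun q : Ω × (unitCube N × unitCube N) =>
      heatKernel ε (X q.2.1 q.1 - x) * heatKernel δ (X q.2.2 q.1 - x))
      (P.prod ((lebesgueCube N).prod (lebesgueCube N))) := by
    refine Integrable.of_bound (C := 1 / (2 * Real.pi * ε) ^ ((d : ℝ) / 2) *
      (1 / (2 * Real.pi * δ) ^ ((d : ℝ) / 2))) ?_ (ae_of_all _ fun q => ?_)
    · exact (((hm ε).comp (measurable_fst.prodMk measurable_snd.fst)).mul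
        ((hm δ).comp (measurable_fst.prodMk measurable_snd.snd))).aestronglyMeasurable
    · rw [norm_mul]
      exact mul_le_mul (norm_heatKernel_le hε _) (norm_heatKernel_le hδ _) (norm_nonneg _)
        (by positivity)
  have e : ∀ ω, approxLocalTime X x ε ω * approxLocalTime X x δ ω =
      ∫ p : unitCube N × unitCube N, heatKernel ε (X p.1 ω - x) * heatKernel δ (X p.2 ω - x)
        ∂((lebesgueCube N).prod (lebesgueCube N)) := fun ω => by
    rw [integral_prod_mul (fun s => heatKernel ε (X s ω - x)) fun s => heatKernel δ (X s ω - x)]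
    rfl
  simp_rw [e]
  rw [integral_integral_swap hint]
  exact integral_congr_ae (ae_of_all _ fun p =>
    integral_heatKernel_mul hX₀ hXmeas hX x hε hδ p.1 p.2)

end SecondMoment

lemma gaussianDensityDiag_nonneg (A b C x : ℝ) : 0 ≤ gaussianDensityDiag A b C x := by
  have := Real.pi_pos
  unfold gaussianDensityDiag; positivity

lemma heatKernelCorr_nonneg {N d : ℕ} {Ω₀ : Type*} [MeasurableSpace Ω₀]
    (X₀ : unitCube N → Ω₀ → ℝ) (P₀ : Measure Ω₀) (x : EuclideanSpace ℝ (Fin d)) (ε δ : ℝ)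
    (p : unitCube N × unitCube N) : 0 ≤ heatKernelCorr X₀ P₀ x ε δ p :=
  Finset.prod_nonneg fun _ _ => gaussianDensityDiag_nonneg _ _ _ _

lemma measurable_heatKernelCorr {N d : ℕ} {Ω₀ : Type*} [MeasurableSpace Ω₀]
    {X₀ : unitCube N → Ω₀ → ℝ} {P₀ : Measure Ω₀} (hX₀ : IsCenteredGaussianField X₀ P₀)
    (x : EuclideanSpace ℝ (Fin d)) (ε δ : ℝ) :
    Measurable (heatKernelCorr X₀ P₀ x ε δ) := by
  have h := hX₀.covFun_continuous
  have h1 : Measurable fun p : unitCube N × unitCube N => covFun X₀ P₀ p.1 p.2 := h.measurable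
  have h2 : Measurable fun p : unitCube N × unitCube N => covFun X₀ P₀ p.1 p.1 :=
    (h.comp (continuous_fst.prodMk continuous_fst)).measurable
  have h3 : Measurable fun p : unitCube N × unitCube N => covFun X₀ P₀ p.2 p.2 :=
    (h.comp (continuous_snd.prodMk continuous_snd)).measurable
  unfold heatKernelCorr gaussianDensityDiag
  fun_prop

/-- Convergence of the correlations at nondegenerate pairs. -/
lemma tendsto_heatKernelCorr {N d : ℕ} {Ω₀ : Type*} [MeasurableSpace Ω₀]
    {X₀ : unitCube N → Ω₀ → ℝ} {P₀ : Measure Ω₀} (x : EuclideanSpace ℝ (Fin d))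
    {p : unitCube N × unitCube N}
    (hp : 0 < covFun X₀ P₀ p.1 p.1 * covFun X₀ P₀ p.2 p.2 - covFun X₀ P₀ p.1 p.2 ^ 2) :
    Tendsto (fun q : ℝ × ℝ => heatKernelCorr X₀ P₀ x q.1 q.2 p)
      (𝓝[>] 0 ×ˢ 𝓝[>] 0) (𝓝 (heatKernelCorr X₀ P₀ x 0 0 p)) := by
  have hc : ContinuousAt (fun q : ℝ × ℝ => heatKernelCorr X₀ P₀ x q.1 q.2 p) (0, 0) := by
    have hpi := Real.pi_pos
    unfold heatKernelCorr gaussianDensityDiag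
    refine tendsto_finsetProd _ fun i _ => ?_
    refine ContinuousAt.mul (ContinuousAt.inv₀ (by fun_prop) ?_) (ContinuousAt.rexp
      (ContinuousAt.neg (ContinuousAt.div (by fun_prop) (by fun_prop) ?_)))
    · simp only [add_zero]; positivity
    · simp only [add_zero]; positivity
  have hle : (𝓝[>] (0 : ℝ) ×ˢ 𝓝[>] (0 : ℝ)) ≤ 𝓝 ((0 : ℝ), (0 : ℝ)) := by
    rw [nhds_prod_eq]
    exact Filter.prod_mono nhdsWithin_le_nhds nhdsWithin_le_nhds
  exact hc.tendsto.mono_left hle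

/-! ### The integrable majorant -/

lemma intervalIntegrable_abs_rpow {r : ℝ} (hr : -1 < r) :
    IntervalIntegrable (fun u : ℝ => |u| ^ r) volume (-1) 1 := by
  have h1 : IntervalIntegrable (fun u : ℝ => |u| ^ r) volume 0 1 := by
    refine (intervalIntegral.intervalIntegrable_rpow' (a := 0) (b := 1) hr).congr
      fun u hu => ?_
    rw [Set.uIoc_of_le zero_le_one] at hu
    simp only [abs_of_pos hu.1]
  have h2 : IntervalIntegrable (fun u : ℝ => |u| ^ r) volume (-1) 0 := by
    rw [IntervalIntegrable.iff_comp_neg]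
    simpa using h1.symm
  exact h2.trans h1

/-- The two-point singular kernel dominating the correlations coordinatewise. -/
def singularKernel (α : ℝ) (q : ℝ × ℝ) : ℝ := |q.1| ^ (-α) * (|q.1 - q.2| ^ (-α) + |q.2| ^ (-α))

/-- The shear `(u, v) ↦ (u, v - u)` separates the variables of the difference term; differences stay
in `[-1, 1]`, whence the larger interval. -/
lemma integrable_singularKernel {α : ℝ} (hα : α < 1) :
    Integrable (singularKernel α) (((volume : Measure ℝ).restrict (Set.Icc 0 1)).prod
      ((volume : Measure ℝ).restrict (Set.Icc 0 1))) := by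
  have h0 : IntegrableOn (fun u : ℝ => |u| ^ (-α)) (Set.Icc (-1) 1) := by
    have := intervalIntegrable_abs_rpow (r := -α) (by linarith)
    rwa [intervalIntegrable_iff_integrableOn_Icc_of_le (by norm_num)] at this
  have h1 : IntegrableOn (fun u : ℝ => |u| ^ (-α)) (Set.Icc 0 1) :=
    h0.mono_set (Set.Icc_subset_Icc (by norm_num) le_rfl)
  have h2 : Integrable (fun q : ℝ × ℝ => |q.1| ^ (-α) * |q.2| ^ (-α))
      (((volume : Measure ℝ).restrict (Set.Icc 0 1)).prod
      ((volume : Measure ℝ).restrict (Set.Icc 0 1))) := h1.mul_prod h1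
  have h3 : Integrable (fun q : ℝ × ℝ => (Set.Icc (0 : ℝ) 1).indicator (fun u => |u| ^ (-α)) q.1 *
      (Set.Icc (-1 : ℝ) 1).indicator (fun u => |u| ^ (-α)) q.2) (volume.prod volume) :=
    (h1.integrable_indicator measurableSet_Icc).mul_prod
      (h0.integrable_indicator measurableSet_Icc)
  have h4 := (measurePreserving_prod_sub (volume : Measure ℝ)
    (volume : Measure ℝ)).integrable_comp_of_integrable h3
  have h5 : Integrable (fun q : ℝ × ℝ => |q.1| ^ (-α) * |q.1 - q.2| ^ (-α))
      (((volume : Measure ℝ).restrict (Set.Icc 0 1)).prod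
      ((volume : Measure ℝ).restrict (Set.Icc 0 1))) := by
    rw [Measure.prod_restrict]
    refine (h4.integrableOn (s := Set.Icc 0 1 ×ˢ Set.Icc 0 1)).congr_fun ?_
      (measurableSet_Icc.prod measurableSet_Icc)
    rintro ⟨a, b⟩ ⟨ha, hb⟩
    simp only [Set.mem_Icc] at ha hb
    simp only [Function.comp_apply]
    rw [Set.indicator_of_mem (Set.mem_Icc.2 ha), Set.indicator_of_mem, abs_sub_comm]
    constructor <;> linarith
  refine (h5.add h2).congr (ae_of_all _ fun q => ?_)
  simp only [singularKernel, Pi.add_apply]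
  ring

/-- Off this null set the product lower bound for the determinant is strictly positive. -/
lemma ae_coords_lebesgueCube (N : ℕ) :
    ∀ᵐ p : unitCube N × unitCube N ∂((lebesgueCube N).prod (lebesgueCube N)),
      ∀ j, 0 < p.1.1 j ∧ 0 < p.2.1 j ∧ p.1.1 j ≠ p.2.1 j := by
  have h1 : ∀ᵐ u : ℝ ∂((volume : Measure ℝ).restrict (Set.Icc 0 1)), 0 < u := by
    have : ∀ᵐ u : ℝ ∂((volume : Measure ℝ).restrict (Set.Icc 0 1)), u ≠ 0 :=
      Measure.ae_ne _ 0
    filter_upwards [this, ae_restrict_mem measurableSet_Icc] with u hu hm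
    exact lt_of_le_of_ne hm.1 hu.symm
  have h2 : ∀ᵐ q : ℝ × ℝ ∂(((volume : Measure ℝ).restrict (Set.Icc 0 1)).prod
      ((volume : Measure ℝ).restrict (Set.Icc 0 1))), 0 < q.1 ∧ 0 < q.2 ∧ q.1 ≠ q.2 := by
    have h3 : ∀ᵐ q : ℝ × ℝ ∂(((volume : Measure ℝ).restrict (Set.Icc 0 1)).prod
      ((volume : Measure ℝ).restrict (Set.Icc 0 1))), q.1 ≠ q.2 := by
      have hd : MeasurableSet {q : ℝ × ℝ | ¬ q.1 ≠ q.2} := by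
        simpa only [not_not] using measurableSet_eq_fun measurable_fst measurable_snd
      rw [ae_iff, Measure.measure_prod_null hd]
      refine ae_of_all _ fun u => ?_
      have : (Prod.mk u ⁻¹' {q : ℝ × ℝ | ¬ q.1 ≠ q.2}) = {u} := by
        ext v; simp [eq_comm]
      change ((volume : Measure ℝ).restrict (Set.Icc 0 1))
        (Prod.mk u ⁻¹' {q : ℝ × ℝ | ¬ q.1 ≠ q.2}) = 0
      rw [this]
      exact measure_singleton u
    filter_upwards [Measure.quasiMeasurePreserving_fst.ae h1,
      Measure.quasiMeasurePreserving_snd.ae h1, h3] with q a b c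
    exact ⟨a, b, c⟩
  refine (measurePreserving_coords_lebesgueCube N).quasiMeasurePreserving.ae
    (p := fun f => ∀ j, 0 < (f j).1 ∧ 0 < (f j).2 ∧ (f j).1 ≠ (f j).2) ?_
  rw [ae_all_iff]
  intro j
  exact (Measure.quasiMeasurePreserving_eval (μ := fun _ : Fin N =>
    ((volume : Measure ℝ).restrict (Set.Icc 0 1)).prod
      ((volume : Measure ℝ).restrict (Set.Icc 0 1))) j).ae h2

lemma integrable_prod_singularKernel (N : ℕ) {α : ℝ} (hα : α < 1) :
    Integrable (fun p : unitCube N × unitCube N => ∏ j, singularKernel α (p.1.1 j, p.2.1 j))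
      ((lebesgueCube N).prod (lebesgueCube N)) :=
  (measurePreserving_coords_lebesgueCube N).integrable_comp_of_integrable
    (Integrable.fintype_prod fun _ => integrable_singularKernel hα)

/-- Anisotropic arithmetic-geometric mean inequality. -/
lemma prod_rpow_le_sum_rpow {N : ℕ} (hN : 0 < N) {H : Fin N → ℝ} (hH : ∀ j, 0 < H j)
    {u : Fin N → ℝ} (hu : ∀ j, 0 ≤ u j) :
    ∏ j, u j ^ (2 / ∑ k, 1 / H k) ≤ ∑ j, u j ^ (2 * H j) := by
  have : Nonempty (Fin N) := ⟨⟨0, hN⟩⟩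
  have hQ : 0 < ∑ k, 1 / H k := Finset.sum_pos (fun j _ => one_div_pos.2 (hH j))
    Finset.univ_nonempty
  have hw : ∀ j, 0 ≤ (1 / H j) / ∑ k, 1 / H k := fun j =>
    div_nonneg (one_div_pos.2 (hH j)).le hQ.le
  have hsum : ∑ j, (1 / H j) / ∑ k, 1 / H k = 1 := by
    rw [← Finset.sum_div, div_self hQ.ne']
  -- The weights are proportional to `1 / H j`, so that every `u j` gets the same exponent `2 / Q`.
  have h := Real.geom_mean_le_arith_mean_weighted Finset.univ
    (fun j => (1 / H j) / ∑ k, 1 / H k) (fun j => u j ^ (2 * H j)) (fun j _ => hw j) hsum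
    (fun j _ => Real.rpow_nonneg (hu j) _)
  calc ∏ j, u j ^ (2 / ∑ k, 1 / H k)
      = ∏ j, (u j ^ (2 * H j)) ^ ((1 / H j) / ∑ k, 1 / H k) := by
        refine Finset.prod_congr rfl fun j _ => ?_
        rw [← Real.rpow_mul (hu j)]
        have := (hH j).ne'
        congr 1
        field_simp
    _ ≤ _ := h
    _ ≤ _ := by
        refine Finset.sum_le_sum fun j hj => mul_le_of_le_one_left (Real.rpow_nonneg (hu j) _) ?_
        exact (Finset.single_le_sum (fun j _ => hw j) hj).trans hsum.le

/-- A minimum is one of its arguments, so its power is at most the sum of both powers, whatever the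
sign of the exponent. -/
lemma prod_min_rpow_le {N : ℕ} {α : ℝ} {s t : Fin N → ℝ}
    (h : ∀ j, 0 < s j ∧ 0 < t j ∧ s j ≠ t j) :
    ∏ j, (s j * min (|s j - t j|) (t j)) ^ (-α) ≤ ∏ j, singularKernel α (s j, t j) := by
  refine Finset.prod_le_prod (fun j _ => ?_) fun j _ => ?_
  · exact Real.rpow_nonneg (mul_nonneg (h j).1.le (le_min (abs_nonneg _) (h j).2.1.le)) _
  · rw [Real.mul_rpow (h j).1.le (le_min (abs_nonneg _) (h j).2.1.le), singularKernel]
    simp only [abs_of_pos (h j).1, abs_of_pos (h j).2.1]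
    refine mul_le_mul_of_nonneg_left ?_ (Real.rpow_nonneg (h j).1.le _)
    have h1 := Real.rpow_nonneg (abs_nonneg (s j - t j)) (-α)
    have h2 := Real.rpow_nonneg (h j).2.1.le (-α)
    rcases min_choice (|s j - t j|) (t j) with e | e <;> rw [e] <;> linarith

/-! ### Limits in `L²` from mixed second moments -/

/-- A family of square-integrable functions whose mixed second moments converge has a limit
in `L²`. -/
lemma exists_tendsto_eLpNorm_of_tendsto_integral_mul {Ω : Type*} [MeasurableSpace Ω]
    {P : Measure Ω} {F : ℝ → Ω → ℝ} (hF : ∀ ε, 0 < ε → MemLp (F ε) 2 P) {l : ℝ}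
    (h : Tendsto (fun q : ℝ × ℝ => ∫ ω, F q.1 ω * F q.2 ω ∂P) (𝓝[>] 0 ×ˢ 𝓝[>] 0) (𝓝 l)) :
    ∃ L : Ω → ℝ, MemLp L 2 P ∧
      Tendsto (fun ε : ℝ => eLpNorm (fun ω => F ε ω - L ω) 2 P) (𝓝[>] 0) (𝓝 0) := by
  classical
  let G : ℝ → Lp ℝ 2 P := fun ε => if hε : 0 < ε then (hF ε hε).toLp (F ε) else 0
  have hG : ∀ ε (hε : 0 < ε), G ε = (hF ε hε).toLp (F ε) := fun ε hε => dif_pos hε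
  have hinner : ∀ ε δ, 0 < ε → 0 < δ → inner ℝ (G ε) (G δ) = ∫ ω, F ε ω * F δ ω ∂P := by
    intro ε δ hε hδ
    rw [hG ε hε, hG δ hδ, L2.inner_def]
    refine integral_congr_ae ?_
    filter_upwards [(hF ε hε).coeFn_toLp, (hF δ hδ).coeFn_toLp] with ω h1 h2
    rw [h1, h2]
    simp [mul_comm]
  have hpos1 : ∀ᶠ q : ℝ × ℝ in 𝓝[>] 0 ×ˢ 𝓝[>] 0, 0 < q.1 :=
    tendsto_fst.eventually self_mem_nhdsWithin
  have hpos2 : ∀ᶠ q : ℝ × ℝ in 𝓝[>] 0 ×ˢ 𝓝[>] 0, 0 < q.2 :=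
    tendsto_snd.eventually self_mem_nhdsWithin
  have hd : Tendsto (fun ε : ℝ => ∫ ω, F ε ω * F ε ω ∂P) (𝓝[>] 0) (𝓝 l) :=
    h.comp (tendsto_id.prodMk tendsto_id)
  -- Cauchy property: the squared distance expands into three inner products tending to `l - 2l + l
  -- = 0`.
  have hsq : Tendsto (fun q : ℝ × ℝ => dist (G q.1) (G q.2)) (𝓝[>] 0 ×ˢ 𝓝[>] 0) (𝓝 0) := by
    have h1 : Tendsto (fun q : ℝ × ℝ => √((∫ ω, F q.1 ω * F q.1 ω ∂P) -
        2 * (∫ ω, F q.1 ω * F q.2 ω ∂P) + ∫ ω, F q.2 ω * F q.2 ω ∂P))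
        (𝓝[>] 0 ×ˢ 𝓝[>] 0) (𝓝 0) := by
      have := (((hd.comp tendsto_fst).sub (h.const_mul 2)).add (hd.comp tendsto_snd)).sqrt
      have hl : √(l - 2 * l + l) = 0 := by ring_nf; simp
      rwa [hl] at this
    refine h1.congr' ?_
    filter_upwards [hpos1, hpos2] with q hq1 hq2
    rw [dist_eq_norm, ← hinner _ _ hq1 hq1, ← hinner _ _ hq1 hq2, ← hinner _ _ hq2 hq2,
      real_inner_self_eq_norm_sq, real_inner_self_eq_norm_sq, ← norm_sub_sq_real,
      Real.sqrt_sq (norm_nonneg _)]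
  have hC : Cauchy (map G (𝓝[>] 0)) :=
    cauchy_map_iff.2 ⟨inferInstance, tendsto_uniformity_iff_dist_tendsto_zero.2 hsq⟩
  obtain ⟨L, hL⟩ := CompleteSpace.complete hC
  have hL' : Tendsto G (𝓝[>] 0) (𝓝 L) := hL
  refine ⟨L, Lp.memLp L, ?_⟩
  rw [Lp.tendsto_Lp_iff_tendsto_eLpNorm'] at hL'
  refine hL'.congr' ?_
  filter_upwards [self_mem_nhdsWithin] with ε (hε : 0 < ε)
  refine eLpNorm_congr_ae ?_
  rw [hG ε hε]
  filter_upwards [(hF ε hε).coeFn_toLp] with ω h1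
  simp [h1]

/-! ### Upper bounds and sufficiency -/

lemma gaussianDensityDiag_le {A b C : ℝ} (hA : 0 ≤ A) (hC : 0 ≤ C) (hD : 0 < A * C - b ^ 2)
    (x : ℝ) : gaussianDensityDiag A b C x ≤ (√(A * C - b ^ 2))⁻¹ := by
  have hs := Real.sqrt_pos.2 hD
  -- Otherwise `4b² > (A + C)² ≥ 4AC`, against `hD`.
  have h1 : 0 ≤ A + C - 2 * b := by
    by_contra hcon
    nlinarith [sq_nonneg (A - C)]
  have h2 : Real.exp (-(x ^ 2 * (A + C - 2 * b) / (2 * (A * C - b ^ 2)))) ≤ 1 :=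
    Real.exp_le_one_iff.2 (neg_nonpos.2 (by positivity))
  have hpi := Real.two_le_pi
  refine (mul_le_of_le_one_right (by positivity) h2).trans ?_
  refine inv_anti₀ hs ?_
  nlinarith

lemma heatKernelCorr_le {N d : ℕ} {Ω₀ : Type*} [MeasurableSpace Ω₀] (P₀ : Measure Ω₀)
    (X₀ : unitCube N → Ω₀ → ℝ) (x : EuclideanSpace ℝ (Fin d)) {ε δ : ℝ} (hε : 0 ≤ ε) (hδ : 0 ≤ δ)
    {p : unitCube N × unitCube N} {D : ℝ} (hD : 0 < D)
    (hp : D ≤ (covFun X₀ P₀ p.1 p.1 + ε) * (covFun X₀ P₀ p.2 p.2 + δ) -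
      covFun X₀ P₀ p.1 p.2 ^ 2) :
    heatKernelCorr X₀ P₀ x ε δ p ≤ D ^ (-((d : ℝ) / 2)) := by
  have h1 := covFun_self_nonneg X₀ P₀ p.1
  have h2 := covFun_self_nonneg X₀ P₀ p.2
  have h3 : ∀ i, gaussianDensityDiag (covFun X₀ P₀ p.1 p.1 + ε) (covFun X₀ P₀ p.1 p.2)
      (covFun X₀ P₀ p.2 p.2 + δ) (x i) ≤ (√D)⁻¹ := fun i =>
    (gaussianDensityDiag_le (by positivity) (by positivity) (hD.trans_le hp) _).trans
      (inv_anti₀ (Real.sqrt_pos.2 hD) (Real.sqrt_le_sqrt hp))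
  refine (Finset.prod_le_prod (fun i _ => gaussianDensityDiag_nonneg _ _ _ _)
    fun i _ => h3 i).trans (le_of_eq ?_)
  rw [Finset.prod_const, Finset.card_univ, Fintype.card_fin, Real.sqrt_eq_rpow,
    ← Real.rpow_neg hD.le, ← Real.rpow_natCast, ← Real.rpow_mul hD.le]
  congr 1; ring

/-- Smoothing only increases the determinant, so one lower bound serves all `ε`, `δ`; the gain `ε *
δ` alone gives boundedness at fixed `ε`, `δ`. -/
lemma det_add_le {N : ℕ} {Ω₀ : Type*} [MeasurableSpace Ω₀] (P₀ : Measure Ω₀)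
    (X₀ : unitCube N → Ω₀ → ℝ) (s t : unitCube N) {ε δ : ℝ} (hε : 0 ≤ ε) (hδ : 0 ≤ δ) :
    covFun X₀ P₀ s s * covFun X₀ P₀ t t - covFun X₀ P₀ s t ^ 2 + ε * δ ≤
      (covFun X₀ P₀ s s + ε) * (covFun X₀ P₀ t t + δ) - covFun X₀ P₀ s t ^ 2 := by
  nlinarith [mul_nonneg (covFun_self_nonneg X₀ P₀ s) hδ, mul_nonneg (covFun_self_nonneg X₀ P₀ t) hε]

section Sufficiency

variable {N d : ℕ} {Ω₀ : Type*} [MeasurableSpace Ω₀]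
    {P₀ : Measure Ω₀} [IsProbabilityMeasure P₀] {X₀ : unitCube N → Ω₀ → ℝ}

lemma det_lower_bound (hN : 0 < N) (hX₀ : IsCenteredGaussianField X₀ P₀)
    {H : Fin N → ℝ} (hH : ∀ j, 0 < H j) {c₂ : ℝ} (hc₂ : 0 < c₂)
    (h : ∀ s t : unitCube N, ∀ᵐ ω ∂P₀,
      c₂ * ∑ j, min (|s.1 j - t.1 j| ^ (2 * H j)) (|t.1 j| ^ (2 * H j)) ≤
        condVar (MeasurableSpace.comap (X₀ s) inferInstance) (X₀ t) P₀ ω) (s t : unitCube N) :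
    c₂ ^ 2 * ∏ j, (s.1 j * min (|s.1 j - t.1 j|) (t.1 j)) ^ (2 / ∑ k, 1 / H k) ≤
      covFun X₀ P₀ s s * covFun X₀ P₀ t t - covFun X₀ P₀ s t ^ 2 := by
  have hs : ∀ j, 0 ≤ s.1 j := fun j => s.2.1 j
  have ht : ∀ j, 0 ≤ t.1 j := fun j => t.2.1 j
  have hm : ∀ j, 0 ≤ min (|s.1 j - t.1 j|) (t.1 j) := fun j => le_min (abs_nonneg _) (ht j)
  refine le_trans ?_ (condC2_mul_le_det hX₀ (h s t))
  have h1 := condC2_le_variance hX₀ h s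
  have h2 := prod_rpow_le_sum_rpow hN hH hs
  have h3 := prod_rpow_le_sum_rpow hN hH hm
  have e1 : ∑ j, |s.1 j| ^ (2 * H j) = ∑ j, s.1 j ^ (2 * H j) :=
    Finset.sum_congr rfl fun j _ => by rw [abs_of_nonneg (hs j)]
  have e2 : ∑ j, min (|s.1 j - t.1 j|) (t.1 j) ^ (2 * H j) =
      ∑ j, min (|s.1 j - t.1 j| ^ (2 * H j)) (|t.1 j| ^ (2 * H j)) :=
    Finset.sum_congr rfl fun j _ => by
      have hmono : MonotoneOn (fun u : ℝ => u ^ (2 * H j)) (Set.Ici 0) := fun a ha b _ hab =>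
        Real.rpow_le_rpow ha hab (by have := hH j; positivity)
      rw [abs_of_nonneg (ht j)]
      exact hmono.map_min (Set.mem_Ici.2 (abs_nonneg _)) (Set.mem_Ici.2 (ht j))
  rw [e1] at h1
  rw [e2] at h3
  have e3 : ∏ j, (s.1 j * min (|s.1 j - t.1 j|) (t.1 j)) ^ (2 / ∑ k, 1 / H k) =
      (∏ j, s.1 j ^ (2 / ∑ k, 1 / H k)) *
        ∏ j, min (|s.1 j - t.1 j|) (t.1 j) ^ (2 / ∑ k, 1 / H k) := by
    rw [← Finset.prod_mul_distrib]
    exact Finset.prod_congr rfl fun j _ => Real.mul_rpow (hs j) (hm j)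
  rw [e3]
  have h4 := (mul_le_mul_of_nonneg_left h2 hc₂.le).trans h1
  have h5 := mul_le_mul_of_nonneg_left h3 hc₂.le
  have h6 := mul_le_mul h4 h5 (mul_nonneg hc₂.le
    (Finset.prod_nonneg fun j _ => Real.rpow_nonneg (hm j) _)) (covFun_self_nonneg X₀ P₀ s)
  linarith

lemma tendsto_integral_heatKernelCorr (hN : 0 < N) (hX₀ : IsCenteredGaussianField X₀ P₀)
    {H : Fin N → ℝ} (hH : ∀ j, 0 < H j) (hC2 : CondC2 X₀ P₀ H) (x : EuclideanSpace ℝ (Fin d))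
    (hd : (d : ℝ) < ∑ j, 1 / H j) :
    Tendsto (fun q : ℝ × ℝ => ∫ p, heatKernelCorr X₀ P₀ x q.1 q.2 p
      ∂((lebesgueCube N).prod (lebesgueCube N))) (𝓝[>] 0 ×ˢ 𝓝[>] 0)
      (𝓝 (∫ p, heatKernelCorr X₀ P₀ x 0 0 p ∂((lebesgueCube N).prod (lebesgueCube N)))) := by
  obtain ⟨c₂, hc₂, h⟩ := hC2
  have hQ : 0 < ∑ k, 1 / H k := (Nat.cast_nonneg d).trans_lt hd
  have hα : (d : ℝ) / ∑ k, 1 / H k < 1 := (div_lt_one hQ).2 hd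
  have hz : ∀ p : unitCube N × unitCube N,
      (∀ j, 0 < p.1.1 j ∧ 0 < p.2.1 j ∧ p.1.1 j ≠ p.2.1 j) →
      ∀ j, 0 < p.1.1 j * min (|p.1.1 j - p.2.1 j|) (p.2.1 j) := fun p hp j =>
    mul_pos (hp j).1 (lt_min (abs_pos.2 (sub_ne_zero.2 (hp j).2.2)) (hp j).2.1)
  have hDpos : ∀ p : unitCube N × unitCube N,
      (∀ j, 0 < p.1.1 j ∧ 0 < p.2.1 j ∧ p.1.1 j ≠ p.2.1 j) →
      0 < c₂ ^ 2 * ∏ j, (p.1.1 j * min (|p.1.1 j - p.2.1 j|) (p.2.1 j)) ^ (2 / ∑ k, 1 / H k) :=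
    fun p hp => mul_pos (by positivity)
      (Finset.prod_pos fun j _ => Real.rpow_pos_of_pos (hz p hp j) _)
  -- The determinant bound has exponent `2 / Q`; the power `-d/2` turns it into `-d/Q`, which
  -- exceeds `-1`.
  refine tendsto_integral_filter_of_dominated_convergence
    (fun p => (c₂ ^ 2) ^ (-((d : ℝ) / 2)) *
      ∏ j, singularKernel ((d : ℝ) / ∑ k, 1 / H k) (p.1.1 j, p.2.1 j)) ?_ ?_ ?_ ?_
  · exact Eventually.of_forall fun q => (measurable_heatKernelCorr hX₀ x _ _).aestronglyMeasurable
  · have hpos1 : ∀ᶠ q : ℝ × ℝ in 𝓝[>] 0 ×ˢ 𝓝[>] 0, 0 < q.1 :=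
      tendsto_fst.eventually self_mem_nhdsWithin
    have hpos2 : ∀ᶠ q : ℝ × ℝ in 𝓝[>] 0 ×ˢ 𝓝[>] 0, 0 < q.2 :=
      tendsto_snd.eventually self_mem_nhdsWithin
    filter_upwards [hpos1, hpos2] with q hq1 hq2
    filter_upwards [ae_coords_lebesgueCube N] with p hp
    rw [Real.norm_of_nonneg (heatKernelCorr_nonneg _ _ _ _ _ _)]
    have hdet := det_add_le P₀ X₀ p.1 p.2 hq1.le hq2.le
    refine (heatKernelCorr_le P₀ X₀ x hq1.le hq2.le (hDpos p hp)
      ((det_lower_bound hN hX₀ hH hc₂ h p.1 p.2).trans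
        (by linarith [mul_pos hq1 hq2]))).trans ?_
    have hnn : ∀ j, 0 ≤ (p.1.1 j * min (|p.1.1 j - p.2.1 j|) (p.2.1 j)) ^ (2 / ∑ k, 1 / H k) :=
      fun j => Real.rpow_nonneg (hz p hp j).le _
    rw [Real.mul_rpow (by positivity) (Finset.prod_nonneg fun j _ => hnn j),
      ← Real.finsetProd_rpow _ _ (fun j _ => hnn j)]
    refine mul_le_mul_of_nonneg_left (le_trans (le_of_eq ?_) (prod_min_rpow_le hp))
      (by positivity)
    refine Finset.prod_congr rfl fun j _ => ?_
    rw [← Real.rpow_mul (hz p hp j).le]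
    congr 1
    field_simp
  · exact (integrable_prod_singularKernel N hα).const_mul _
  · filter_upwards [ae_coords_lebesgueCube N] with p hp
    exact tendsto_heatKernelCorr x
      ((hDpos p hp).trans_le (det_lower_bound hN hX₀ hH hc₂ h p.1 p.2))

end Sufficiency

/-! ### Divergence of the gauge integral -/

/-- The anisotropic gauge `∑ⱼ |uⱼ|^{2Hⱼ}`. -/
def anisoGauge {N : ℕ} (H : Fin N → ℝ) (u : Fin N → ℝ) : ℝ := ∑ j, |u j| ^ (2 * H j)

lemma measurable_anisoGauge {N : ℕ} (H : Fin N → ℝ) : Measurable (anisoGauge H) := by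
  unfold anisoGauge
  refine Finset.measurable_fun_sum _ fun j _ => ?_
  have h : Measurable fun u : Fin N → ℝ => |u j| :=
    continuous_abs.measurable.comp (measurable_pi_apply j)
  exact h.pow_const _

/-- The power `-d/2` of the anisotropic gauge is not integrable at the origin when
`∑ⱼ 1/Hⱼ ≤ d`. -/
lemma lintegral_anisoGauge_eq_top {N d : ℕ} (hN : 0 < N) {H : Fin N → ℝ} (hH : ∀ j, 0 < H j)
    (hd : ∑ j, 1 / H j ≤ d) :
    ∫⁻ u in Set.univ.pi fun _ : Fin N => Set.Ioc (0 : ℝ) (1 / 4),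
      ENNReal.ofReal (anisoGauge H u ^ (-((d : ℝ) / 2))) = ⊤ := by
  have hNe : Nonempty (Fin N) := ⟨⟨0, hN⟩⟩
  have hN' : (0 : ℝ) < N := by exact_mod_cast hN
  by_contra hfin
  -- Scaling coordinate `j` by `a j` divides the gauge by `4` and multiplies volume by `r = 2^(-Q)`.
  set a : Fin N → ℝ := fun j => (2 : ℝ) ^ (-(1 / H j)) with ha
  have ha0 : ∀ j, 0 < a j := fun j => Real.rpow_pos_of_pos two_pos _
  have ha1 : ∀ j, a j < 1 := fun j => Real.rpow_lt_one_of_one_lt_of_neg one_lt_two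
    (neg_neg_of_pos (one_div_pos.2 (hH j)))
  set r : ℝ := ∏ j, a j with hr
  have hr0 : 0 < r := Finset.prod_pos fun j _ => ha0 j
  have hr1 : r < 1 := by
    have := Finset.prod_lt_prod_of_nonempty (s := Finset.univ) (f := a) (g := fun _ => 1)
      (fun j _ => ha0 j) (fun j _ => ha1 j) Finset.univ_nonempty
    simpa using this
  -- Here `Q ≤ d` enters: the integrand's growth factor `2^d` compensates the loss of volume.
  have hr2 : 1 ≤ (2 : ℝ) ^ (d : ℝ) * r := by
    rw [hr, ha, ← Real.rpow_sum_of_pos two_pos, ← Real.rpow_add two_pos, Finset.sum_neg_distrib]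
    exact Real.one_le_rpow one_le_two (by linarith)
  let A : ℕ → Set (Fin N → ℝ) := fun k => Set.univ.pi fun j => Set.Ioc (0 : ℝ) (a j ^ k * (1 / 4))
  have hAsub : ∀ k, A k ⊆ Set.univ.pi fun _ : Fin N => Set.Ioc (0 : ℝ) (1 / 4) := fun k =>
    Set.pi_mono fun j _ => Set.Ioc_subset_Ioc_right
      (mul_le_of_le_one_left (by norm_num) (pow_le_one₀ (ha0 j).le (ha1 j).le))
  have hAm : ∀ k, MeasurableSet (A k) := fun k => MeasurableSet.univ_pi fun _ => measurableSet_Ioc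
  have hvol : ∀ k, volume (A k) = ENNReal.ofReal (r ^ k * (1 / 4) ^ N) := fun k => by
    simp only [A]
    rw [Real.volume_pi_Ioc, ← ENNReal.ofReal_prod_of_nonneg (fun j _ => by
      have := ha0 j; rw [sub_zero]; positivity)]
    simp only [sub_zero]
    rw [Finset.prod_mul_distrib, Finset.prod_pow, Finset.prod_const, Finset.card_univ,
      Fintype.card_fin]
  have hvol0 : Tendsto (fun k => volume (A k)) atTop (𝓝 0) := by
    simp_rw [hvol]
    have := (tendsto_pow_atTop_nhds_zero_of_lt_one hr0.le hr1).mul_const ((1 / 4 : ℝ) ^ N)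
    rw [zero_mul] at this
    simpa using ENNReal.tendsto_ofReal this
  have hgauge : ∀ k, ∀ u ∈ A k, (N : ℝ) ^ (-((d : ℝ) / 2)) * ((2 : ℝ) ^ (d : ℝ)) ^ k ≤
      anisoGauge H u ^ (-((d : ℝ) / 2)) := by
    intro k u hu
    have hu' : ∀ j, 0 < u j ∧ u j ≤ a j ^ k := fun j => by
      have := hu j (Set.mem_univ j)
      have h2 := pow_pos (ha0 j) k
      exact ⟨this.1, this.2.trans (by linarith)⟩
    have h1 : ∀ j, |u j| ^ (2 * H j) ≤ ((1 / 4 : ℝ)) ^ k := fun j => by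
      rw [abs_of_pos (hu' j).1]
      have h3 := hH j
      refine (Real.rpow_le_rpow (hu' j).1.le (hu' j).2 (by positivity)).trans (le_of_eq ?_)
      rw [← Real.rpow_natCast, ← Real.rpow_natCast, ha, ← Real.rpow_mul (by positivity),
        ← Real.rpow_mul (by positivity), show (1 / 4 : ℝ) = 2 ^ (-2 : ℝ) by
          rw [Real.rpow_neg two_pos.le]; norm_num, ← Real.rpow_mul (by positivity)]
      congr 1
      field_simp
    have h2 : anisoGauge H u ≤ N * (1 / 4 : ℝ) ^ k := by
      refine (Finset.sum_le_sum fun j _ => h1 j).trans (le_of_eq ?_)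
      simp
    have h3 : 0 < anisoGauge H u := Finset.sum_pos (fun j _ =>
      Real.rpow_pos_of_pos (abs_pos.2 (hu' j).1.ne') _) Finset.univ_nonempty
    refine le_trans (le_of_eq ?_) (Real.rpow_le_rpow_of_nonpos h3 h2
      (neg_nonpos.2 (by positivity)))
    rw [Real.mul_rpow hN'.le (by positivity)]
    congr 1
    rw [← Real.rpow_natCast, ← Real.rpow_natCast, show (1 / 4 : ℝ) = 2 ^ (-2 : ℝ) by
          rw [Real.rpow_neg two_pos.le]; norm_num, ← Real.rpow_mul (by positivity),
          ← Real.rpow_mul (by positivity), ← Real.rpow_mul (by positivity)]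
    congr 1; ring
  -- A finite integral would be absolutely continuous, hence vanish along the shrinking boxes `A k`;
  -- `hlow` bounds it below uniformly.
  have hlim := tendsto_setLIntegral_zero hfin (s := A) (l := atTop)
    (tendsto_of_tendsto_of_tendsto_of_le_of_le tendsto_const_nhds hvol0 (fun _ => zero_le)
      (fun k => Measure.restrict_apply_le _ _))
  have hlow : ∀ k, ENNReal.ofReal ((N : ℝ) ^ (-((d : ℝ) / 2)) * (1 / 4) ^ N) ≤
      ∫⁻ u in A k, ENNReal.ofReal (anisoGauge H u ^ (-((d : ℝ) / 2)))
        ∂(volume.restrict (Set.univ.pi fun _ : Fin N => Set.Ioc (0 : ℝ) (1 / 4))) := by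
    intro k
    rw [Measure.restrict_restrict (hAm k), Set.inter_eq_left.2 (hAsub k)]
    calc ENNReal.ofReal ((N : ℝ) ^ (-((d : ℝ) / 2)) * (1 / 4) ^ N)
        ≤ ENNReal.ofReal ((N : ℝ) ^ (-((d : ℝ) / 2)) * ((2 : ℝ) ^ (d : ℝ)) ^ k) *
            volume (A k) := by
          rw [hvol, ← ENNReal.ofReal_mul (by positivity)]
          refine ENNReal.ofReal_le_ofReal ?_
          have h1 : 1 ≤ ((2 : ℝ) ^ (d : ℝ) * r) ^ k := one_le_pow₀ hr2
          rw [mul_pow] at h1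
          have h2 : 0 ≤ (N : ℝ) ^ (-((d : ℝ) / 2)) * (1 / 4) ^ N := by positivity
          nlinarith [mul_le_mul_of_nonneg_left h1 h2]
      _ = ∫⁻ _ in A k, ENNReal.ofReal ((N : ℝ) ^ (-((d : ℝ) / 2)) * ((2 : ℝ) ^ (d : ℝ)) ^ k) := by
          rw [setLIntegral_const]
      _ ≤ _ := setLIntegral_mono' (hAm k) fun u hu => ENNReal.ofReal_le_ofReal (hgauge k u hu)
  have h0 := ge_of_tendsto' hlim hlow
  rw [nonpos_iff_eq_zero, ENNReal.ofReal_eq_zero] at h0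
  have : 0 < (N : ℝ) ^ (-((d : ℝ) / 2)) * (1 / 4) ^ N := by positivity
  linarith

/-- Near-diagonal pairs in the middle of the cube carry an infinite gauge integral. -/
lemma lintegral_lebesgueCube_eq_top {N d : ℕ} (hN : 0 < N) {H : Fin N → ℝ} (hH : ∀ j, 0 < H j)
    (hd : ∑ j, 1 / H j ≤ d) {f : unitCube N × unitCube N → ENNReal} {κ : ℝ} (hκ : 0 < κ)
    (hf : ∀ p : unitCube N × unitCube N, (∀ j, 1 / 2 ≤ p.1.1 j) →
      (∀ j, 0 < p.2.1 j - p.1.1 j ∧ p.2.1 j - p.1.1 j ≤ 1 / 4) →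
      ENNReal.ofReal (κ * anisoGauge H (p.2.1 - p.1.1) ^ (-((d : ℝ) / 2))) ≤ f p) :
    ∫⁻ p, f p ∂((lebesgueCube N).prod (lebesgueCube N)) = ⊤ := by
  -- Base points in `B` plus increments in `C` stay in the cube, as `3/4 + 1/4 = 1`.
  let B : Set (Fin N → ℝ) := Set.univ.pi fun _ => Set.Icc (1 / 2 : ℝ) (3 / 4)
  let C : Set (Fin N → ℝ) := Set.univ.pi fun _ => Set.Ioc (0 : ℝ) (1 / 4)
  have hB : MeasurableSet B := MeasurableSet.univ_pi fun _ => measurableSet_Icc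
  have hC : MeasurableSet C := MeasurableSet.univ_pi fun _ => measurableSet_Ioc
  let g : (Fin N → ℝ) → ENNReal := C.indicator fun u =>
    ENNReal.ofReal (κ * anisoGauge H u ^ (-((d : ℝ) / 2)))
  have hgm : Measurable g :=
    (((measurable_anisoGauge H).pow_const _).const_mul κ).ennreal_ofReal.indicator hC
  let G : (Fin N → ℝ) × (Fin N → ℝ) → ENNReal := fun z => B.indicator 1 z.1 * g z.2
  have hGm : Measurable G :=
    ((measurable_one.indicator hB).comp measurable_fst).mul (hgm.comp measurable_snd)
  have hgtop : ∫⁻ u, g u = ⊤ := by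
    rw [lintegral_indicator hC]
    simp_rw [ENNReal.ofReal_mul hκ.le]
    rw [lintegral_const_mul' _ _ ENNReal.ofReal_ne_top, lintegral_anisoGauge_eq_top hN hH hd]
    exact ENNReal.mul_top (ENNReal.ofReal_pos.2 hκ).ne'
  have hGtop : ∫⁻ z, G z ∂((volume : Measure (Fin N → ℝ)).prod volume) = ⊤ := by
    rw [lintegral_prod_mul (measurable_one.indicator hB).aemeasurable hgm.aemeasurable, hgtop,
      lintegral_indicator_one hB]
    refine ENNReal.mul_top ?_
    simp only [B]
    rw [volume_pi, Measure.pi_pi, Finset.prod_ne_zero_iff]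
    intro j _
    rw [Real.volume_Icc]
    exact (ENNReal.ofReal_pos.2 (by norm_num)).ne'
  -- In the variables `(s, t - s)` the integral factors as the positive volume of `B` times an
  -- infinite integral.
  have hshear := (measurePreserving_prod_sub (volume : Measure (Fin N → ℝ))
    (volume : Measure (Fin N → ℝ))).lintegral_comp hGm
  rw [hGtop] at hshear
  have hsupp : ∀ z : (Fin N → ℝ) × (Fin N → ℝ), G (z.1, z.2 - z.1) ≠ 0 →
      (z.1 ∈ B ∧ z.2 - z.1 ∈ C) := by
    intro z hz
    obtain ⟨h1, h2⟩ := mul_ne_zero_iff.1 hz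
    exact ⟨Set.mem_of_indicator_ne_zero h1, Set.mem_of_indicator_ne_zero h2⟩
  have hmem : ∀ z : (Fin N → ℝ) × (Fin N → ℝ), z.1 ∈ B → z.2 - z.1 ∈ C →
      z ∈ (Set.Icc (0 : Fin N → ℝ) 1) ×ˢ (Set.Icc (0 : Fin N → ℝ) 1) := by
    intro z h1 h2
    have h1' := fun j => h1 j (Set.mem_univ j)
    have h2' := fun j => h2 j (Set.mem_univ j)
    simp only [Set.mem_Icc, Set.mem_Ioc, Pi.sub_apply] at h1' h2'
    refine ⟨⟨fun j => ?_, fun j => ?_⟩, ⟨fun j => ?_, fun j => ?_⟩⟩ <;>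
    · simp only [Pi.zero_apply, Pi.one_apply]
      linarith [h1' j, h2' j]
  have hval : MeasurePreserving (fun p : unitCube N × unitCube N => (p.1.1, p.2.1))
      ((lebesgueCube N).prod (lebesgueCube N)) ((volume.prod volume).restrict
        ((Set.Icc (0 : Fin N → ℝ) 1) ×ˢ (Set.Icc (0 : Fin N → ℝ) 1))) := by
    rw [← Measure.prod_restrict]
    have h := measurePreserving_val_lebesgueCube N
    rw [← Measure.restrict_pi_pi, ← volume_pi, Set.pi_univ_Icc] at h
    exact h.prod h
  have hGm' : Measurable fun z : (Fin N → ℝ) × (Fin N → ℝ) => G (z.1, z.2 - z.1) :=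
    hGm.comp (measurable_fst.prodMk (measurable_snd.sub measurable_fst))
  have hcube := hval.lintegral_comp hGm'
  rw [setLIntegral_eq_of_support_subset, hshear] at hcube
  · refine top_unique (hcube.symm.le.trans (lintegral_mono fun p => ?_))
    by_cases h0 : G (p.1.1, p.2.1 - p.1.1) = 0
    · simp only [h0]; exact zero_le
    · obtain ⟨h1, h2⟩ := hsupp (p.1.1, p.2.1) h0
      simp only [G, g]
      rw [Set.indicator_of_mem h1, Set.indicator_of_mem h2, Pi.one_apply, one_mul]
      exact hf p (fun j => (h1 j (Set.mem_univ j)).1) fun j => h2 j (Set.mem_univ j)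
  · intro z hz
    obtain ⟨h1, h2⟩ := hsupp z hz
    exact hmem z h1 h2

/-! ### Lower bounds and necessity -/

/-- The determinant is of order `ρ` and `A + C - 2 * b` is at most of that order, so the exponent
stays bounded for each fixed `x` and only the prefactor `ρ^(-1/2)` is singular. -/
lemma gaussianDensityDiag_ge {A b C x ρ m M c : ℝ} (hρ : 0 < ρ) (hm : 0 < m) (hc : 0 ≤ c)
    (hM : 0 < M) (h1 : m * ρ ≤ A * C - b ^ 2) (h2 : A * C - b ^ 2 ≤ M * ρ)
    (h3 : A + C - 2 * b ≤ c * ρ) :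
    (2 * Real.pi * √M)⁻¹ * Real.exp (-(x ^ 2 * c / (2 * m))) * ρ ^ (-(1 / 2 : ℝ)) ≤
      gaussianDensityDiag A b C x := by
  have hpi := Real.pi_pos
  have hD : 0 < A * C - b ^ 2 := (mul_pos hm hρ).trans_le h1
  have hM' := Real.sqrt_pos.2 hM
  have hρ' := Real.sqrt_pos.2 hρ
  have e : (2 * Real.pi * √M)⁻¹ * Real.exp (-(x ^ 2 * c / (2 * m))) * ρ ^ (-(1 / 2 : ℝ)) =
      (2 * Real.pi * √(M * ρ))⁻¹ * Real.exp (-(x ^ 2 * c / (2 * m))) := by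
    rw [Real.rpow_neg hρ.le, ← Real.sqrt_eq_rpow, Real.sqrt_mul hM.le]
    field_simp
  rw [e, gaussianDensityDiag]
  have h4 : x ^ 2 * (A + C - 2 * b) / (2 * (A * C - b ^ 2)) ≤ x ^ 2 * c / (2 * m) := by
    calc x ^ 2 * (A + C - 2 * b) / (2 * (A * C - b ^ 2))
        ≤ x ^ 2 * (c * ρ) / (2 * (A * C - b ^ 2)) := by gcongr
      _ ≤ x ^ 2 * (c * ρ) / (2 * (m * ρ)) := by gcongr
      _ = x ^ 2 * c / (2 * m) := by field_simp
  have hDs := Real.sqrt_pos.2 hD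
  gcongr

lemma integrable_heatKernelCorr {N d : ℕ} {Ω₀ : Type*} [MeasurableSpace Ω₀] {P₀ : Measure Ω₀}
    {X₀ : unitCube N → Ω₀ → ℝ} (hX₀ : IsCenteredGaussianField X₀ P₀)
    (x : EuclideanSpace ℝ (Fin d)) {ε : ℝ} (hε : 0 < ε) :
    Integrable (heatKernelCorr X₀ P₀ x ε ε) ((lebesgueCube N).prod (lebesgueCube N)) := by
  refine Integrable.of_bound (C := (ε * ε) ^ (-((d : ℝ) / 2)))
    (measurable_heatKernelCorr hX₀ x _ _).aestronglyMeasurable (ae_of_all _ fun p => ?_)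
  rw [Real.norm_of_nonneg (heatKernelCorr_nonneg _ _ _ _ _ _)]
  refine heatKernelCorr_le P₀ X₀ x hε.le hε.le (mul_pos hε hε) (le_trans ?_
    (det_add_le P₀ X₀ p.1 p.2 hε.le hε.le))
  linarith [covFun_sq_le hX₀.memLp_two p.1 p.2]

section Necessity

variable {N d : ℕ} {Ω₀ : Type*} [MeasurableSpace Ω₀]
    {P₀ : Measure Ω₀} [IsProbabilityMeasure P₀] {X₀ : unitCube N → Ω₀ → ℝ}

lemma exists_heatKernelCorr_ge (hN : 0 < N) (hX₀ : IsCenteredGaussianField X₀ P₀)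
    {H : Fin N → ℝ} (hH : ∀ j, H j ∈ Set.Ioo (0 : ℝ) 1) (hC1 : CondC1 X₀ P₀ H)
    (hC2 : CondC2 X₀ P₀ H) (x : EuclideanSpace ℝ (Fin d)) :
    ∃ κ : ℝ, 0 < κ ∧ ∀ p : unitCube N × unitCube N, (∀ j, 1 / 2 ≤ p.1.1 j) →
      (∀ j, 0 < p.2.1 j - p.1.1 j ∧ p.2.1 j - p.1.1 j ≤ 1 / 4) →
      κ * anisoGauge H (p.2.1 - p.1.1) ^ (-((d : ℝ) / 2)) ≤ heatKernelCorr X₀ P₀ x 0 0 p := by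
  have hNe : Nonempty (Fin N) := ⟨⟨0, hN⟩⟩
  obtain ⟨c₁, hc₁, h1⟩ := hC1
  obtain ⟨c₂, hc₂, h2⟩ := hC2
  obtain ⟨K, hK⟩ : ∃ K, ∀ s : unitCube N, ‖covFun X₀ P₀ s s‖ ≤ K := by
    have hcont : Continuous fun s : unitCube N => covFun X₀ P₀ s s :=
      hX₀.covFun_continuous.comp (continuous_id.prodMk continuous_id)
    obtain ⟨K, hK⟩ := isCompact_univ.exists_bound_of_continuousOn hcont.continuousOn
    exact ⟨K, fun s => hK s (Set.mem_univ s)⟩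
  have hpi := Real.pi_pos
  have hK0 : 0 ≤ K := (norm_nonneg _).trans (hK ⟨0, by simp⟩)
  have hM : 0 < (K + 1) * c₁ := by positivity
  refine ⟨∏ i, (2 * Real.pi * √((K + 1) * c₁))⁻¹ *
    Real.exp (-(x i ^ 2 * c₁ / (2 * (c₂ * (1 / 4) * c₂)))), Finset.prod_pos fun i _ => ?_, ?_⟩
  · have := Real.sqrt_pos.2 hM
    positivity
  rintro ⟨s, t⟩ hs hst
  simp only at hs hst
  have hρ : 0 < anisoGauge H (t.1 - s.1) := Finset.sum_pos (fun j _ =>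
    Real.rpow_pos_of_pos (abs_pos.2 (hst j).1.ne') _) Finset.univ_nonempty
  have hgauge : anisoGauge H (t.1 - s.1) = ∑ j, |s.1 j - t.1 j| ^ (2 * H j) :=
    Finset.sum_congr rfl fun j _ => by rw [Pi.sub_apply, abs_sub_comm]
  -- Each increment is at most `1/4` while `t j > 1/2`, so the first argument is the minimum.
  have hmin : ∑ j, min (|s.1 j - t.1 j| ^ (2 * H j)) (|t.1 j| ^ (2 * H j)) =
      anisoGauge H (t.1 - s.1) := by
    rw [hgauge]
    refine Finset.sum_congr rfl fun j _ => min_eq_left ?_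
    refine Real.rpow_le_rpow (abs_nonneg _) ?_ (by have := (hH j).1; positivity)
    rw [abs_sub_comm, abs_of_pos (hst j).1, abs_of_nonneg (t.2.1 j)]
    linarith [hs j, hst j]
  -- One coordinate suffices: `s j ≥ 1/2` and `H j < 1` give `|s j|^(2 H j) ≥ (1/2)² = 1/4`.
  have hvar : c₂ * (1 / 4) ≤ covFun X₀ P₀ s s := by
    refine le_trans (mul_le_mul_of_nonneg_left ?_ hc₂.le) (condC2_le_variance hX₀ h2 s)
    obtain ⟨j⟩ := hNe
    have hj : (1 / 4 : ℝ) ≤ |s.1 j| ^ (2 * H j) := by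
      have hj2 : 1 / 2 ≤ |s.1 j| := (hs j).trans (le_abs_self _)
      have hHj := hH j
      calc (1 / 4 : ℝ) = (1 / 2 : ℝ) ^ (2 : ℝ) := by norm_num
        _ ≤ (1 / 2 : ℝ) ^ (2 * H j) := Real.rpow_le_rpow_of_exponent_ge (by norm_num)
            (by norm_num) (by linarith [hHj.2])
        _ ≤ _ := Real.rpow_le_rpow (by norm_num) hj2 (by linarith [hHj.1])
    exact hj.trans (Finset.single_le_sum (f := fun j => |s.1 j| ^ (2 * H j))
      (fun j _ => Real.rpow_nonneg (abs_nonneg _) _) (Finset.mem_univ j))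
  have hinc : covFun X₀ P₀ s s + covFun X₀ P₀ t t - 2 * covFun X₀ P₀ s t ≤
      c₁ * anisoGauge H (t.1 - s.1) := by
    rw [← integral_sub_sq_eq_covFun hX₀.memLp_two, hgauge]
    exact h1 s t
  have hlow : c₂ * (1 / 4) * c₂ * anisoGauge H (t.1 - s.1) ≤
      covFun X₀ P₀ s s * covFun X₀ P₀ t t - covFun X₀ P₀ s t ^ 2 := by
    refine le_trans ?_ (condC2_mul_le_det hX₀ (h2 s t))
    rw [hmin, mul_assoc]
    exact mul_le_mul_of_nonneg_right hvar (by positivity)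
  have hup : covFun X₀ P₀ s s * covFun X₀ P₀ t t - covFun X₀ P₀ s t ^ 2 ≤
      (K + 1) * c₁ * anisoGauge H (t.1 - s.1) := by
    refine (det_le_covFun_mul s t).trans ?_
    have hb := (le_abs_self _).trans (hK s)
    rw [mul_assoc]
    exact (mul_le_mul_of_nonneg_left hinc (covFun_self_nonneg X₀ P₀ s)).trans
      (mul_le_mul_of_nonneg_right (by linarith) (by positivity))
  have hpow : anisoGauge H (t.1 - s.1) ^ (-((d : ℝ) / 2)) =
      ∏ _i : Fin d, anisoGauge H (t.1 - s.1) ^ (-(1 / 2 : ℝ)) := by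
    rw [Finset.prod_const, Finset.card_univ, Fintype.card_fin, ← Real.rpow_natCast,
      ← Real.rpow_mul hρ.le]
    congr 1; ring
  rw [hpow, ← Finset.prod_mul_distrib, heatKernelCorr]
  refine Finset.prod_le_prod (fun i _ => by positivity) fun i _ => ?_
  simp only [add_zero]
  exact gaussianDensityDiag_ge hρ (by positivity) hc₁.le hM hlow hup hinc

/-- Fatou's lemma for the correlations. -/
lemma lintegral_heatKernelCorr_zero_le (hN : 0 < N) (hX₀ : IsCenteredGaussianField X₀ P₀)
    {H : Fin N → ℝ} (hH : ∀ j, 0 < H j) (hC2 : CondC2 X₀ P₀ H) (x : EuclideanSpace ℝ (Fin d))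
    {b : ENNReal} (hb : ∀ᶠ ε in 𝓝[>] (0 : ℝ), ∫⁻ p, ENNReal.ofReal (heatKernelCorr X₀ P₀ x ε ε p)
      ∂((lebesgueCube N).prod (lebesgueCube N)) ≤ b) :
    ∫⁻ p, ENNReal.ofReal (heatKernelCorr X₀ P₀ x 0 0 p)
      ∂((lebesgueCube N).prod (lebesgueCube N)) ≤ b := by
  obtain ⟨c₂, hc₂, h⟩ := hC2
  have hlim : ∀ᵐ p ∂((lebesgueCube N).prod (lebesgueCube N)),
      ENNReal.ofReal (heatKernelCorr X₀ P₀ x 0 0 p) =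
        liminf (fun ε => ENNReal.ofReal (heatKernelCorr X₀ P₀ x ε ε p)) (𝓝[>] (0 : ℝ)) := by
    filter_upwards [ae_coords_lebesgueCube N] with p hp
    have hD : 0 < covFun X₀ P₀ p.1 p.1 * covFun X₀ P₀ p.2 p.2 - covFun X₀ P₀ p.1 p.2 ^ 2 := by
      refine lt_of_lt_of_le (mul_pos (by positivity) (Finset.prod_pos fun j _ =>
        Real.rpow_pos_of_pos ?_ _)) (det_lower_bound hN hX₀ hH hc₂ h p.1 p.2)
      exact mul_pos (hp j).1 (lt_min (abs_pos.2 (sub_ne_zero.2 (hp j).2.2)) (hp j).2.1)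
    have := (tendsto_heatKernelCorr x hD).comp
      ((tendsto_id (x := 𝓝[>] (0 : ℝ))).prodMk (tendsto_id (x := 𝓝[>] (0 : ℝ))))
    exact (ENNReal.tendsto_ofReal this).liminf_eq.symm
  rw [lintegral_congr_ae hlim]
  refine (lintegral_liminf_le fun ε =>
    (measurable_heatKernelCorr hX₀ x ε ε).ennreal_ofReal).trans ?_
  exact liminf_le_of_frequently_le' hb.frequently

end Necessity

lemma ofReal_integral_mul_self {Ω : Type*} [MeasurableSpace Ω] {P : Measure Ω} {f : Ω → ℝ}
    (hf : MemLp f 2 P) :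
    ENNReal.ofReal (∫ ω, f ω * f ω ∂P) = eLpNorm f 2 P ^ 2 := by
  have hi : Integrable (fun ω => f ω * f ω) P := hf.integrable_mul hf
  rw [ofReal_integral_eq_lintegral_ofReal hi (ae_of_all _ fun ω => mul_self_nonneg _),
    eLpNorm_eq_lintegral_rpow_enorm_toReal two_ne_zero ENNReal.ofNat_ne_top,
    ← ENNReal.rpow_natCast, ← ENNReal.rpow_mul]
  simp only [ENNReal.toReal_ofNat, Nat.cast_ofNat, one_div, isUnit_iff_ne_zero, ne_eq,
    OfNat.ofNat_ne_zero, not_false_eq_true, IsUnit.inv_mul_cancel, ENNReal.rpow_one]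
  refine lintegral_congr fun ω => ?_
  rw [← pow_two, ← Real.enorm_of_nonneg (sq_nonneg _), enorm_pow]
  exact (ENNReal.rpow_ofNat _ 2).symm

end

/-! ### The equivalence -/

theorem mainTheorem2 {N d : ℕ} (hN : 0 < N) {Ω Ω₀ : Type*}
    [MeasurableSpace Ω] [MeasurableSpace Ω₀]
    (P : Measure Ω) [IsProbabilityMeasure P] (P₀ : Measure Ω₀) [IsProbabilityMeasure P₀]
    (X₀ : unitCube N → Ω₀ → ℝ) (hX₀ : IsCenteredGaussianField X₀ P₀)
    (X : unitCube N → Ω → EuclideanSpace ℝ (Fin d))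
    (hXmeas : Measurable (Function.uncurry X))
    (hX : CoordsIndepCopies X P X₀ P₀)
    (H : Fin N → ℝ) (hH : ∀ j, H j ∈ Set.Ioo (0 : ℝ) 1)
    (hC1 : CondC1 X₀ P₀ H) (hC2 : CondC2 X₀ P₀ H)
    (x : EuclideanSpace ℝ (Fin d)) :
    (∃ L : Ω → ℝ, IsLocalTime X P x L) ↔ (d : ℝ) < ∑ j, 1 / H j := by
  have hH0 : ∀ j, 0 < H j := fun j => (hH j).1
  constructor
  · rintro ⟨L, hL, hlim⟩
    by_contra hd
    have hd : ∑ j, 1 / H j ≤ (d : ℝ) := not_lt.1 hd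
    obtain ⟨κ, hκ, hge⟩ := exists_heatKernelCorr_ge hN hX₀ hH hC1 hC2 x
    have htop := lintegral_lebesgueCube_eq_top hN hH0 hd hκ
      (f := fun p => ENNReal.ofReal (heatKernelCorr X₀ P₀ x 0 0 p))
      fun p h1 h2 => ENNReal.ofReal_le_ofReal (hge p h1 h2)
    -- For small `ε` the approximation is within distance `1` of `L` in `L²`, which gives this bound
    -- on its second moment.
    have hle := lintegral_heatKernelCorr_zero_le hN hX₀ hH0 hC2 x
      (b := (1 + eLpNorm L 2 P) ^ 2) ?_
    · rw [htop, top_le_iff] at hle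
      exact ENNReal.pow_ne_top (ENNReal.add_ne_top.2 ⟨ENNReal.one_ne_top, hL.eLpNorm_ne_top⟩) hle
    · filter_upwards [self_mem_nhdsWithin, hlim.eventually_lt_const one_pos] with ε
        (hε : 0 < ε) hε1
      have hmem := memLp_approxLocalTime (P := P) hXmeas x hε
      rw [← ofReal_integral_eq_lintegral_ofReal (integrable_heatKernelCorr hX₀ x hε)
        (ae_of_all _ fun p => heatKernelCorr_nonneg _ _ _ _ _ _),
        ← integral_approxLocalTime_mul hX₀ hXmeas hX x hε hε]
      have hnorm : eLpNorm (approxLocalTime X x ε) 2 P ≤ 1 + eLpNorm L 2 P := by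
        have e : approxLocalTime X x ε = (fun ω => approxLocalTime X x ε ω - L ω) + L := by
          ext ω; simp
        rw [e]
        exact (eLpNorm_add_le (hmem.sub hL).aestronglyMeasurable hL.aestronglyMeasurable
          one_le_two).trans (add_le_add_left hε1.le _)
      rw [ofReal_integral_mul_self hmem]
      exact pow_le_pow_left' hnorm 2
  · intro hd
    have h := tendsto_integral_heatKernelCorr hN hX₀ hH0 hC2 x hd
    refine exists_tendsto_eLpNorm_of_tendsto_integral_mul
      (F := fun ε => approxLocalTime X x ε) (fun ε hε => memLp_approxLocalTime hXmeas x hε)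
      (h.congr' ?_)
    have hpos1 : ∀ᶠ q : ℝ × ℝ in 𝓝[>] 0 ×ˢ 𝓝[>] 0, 0 < q.1 :=
      tendsto_fst.eventually self_mem_nhdsWithin
    have hpos2 : ∀ᶠ q : ℝ × ℝ in 𝓝[>] 0 ×ˢ 𝓝[>] 0, 0 < q.2 :=
      tendsto_snd.eventually self_mem_nhdsWithin
    filter_upwards [hpos1, hpos2] with q hq1 hq2
    exact (integral_approxLocalTime_mul hX₀ hXmeas hX x hq1 hq2).symm
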